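/- **Theorem (Jordan automorphisms of octonion division algebras).** Conventions. For an algebra $A$ with $K$-linear involution $x\mapsto\bar x$ and $\beta\in K$, let $(A,\beta)=\{x+e\cdot y\mid x,y\in A\}$ be its double, with multiplication $(x+e\cdot y)(u+e\cdot v)=(xu+\beta\, v\bar y)+e\cdot(\bar x v+uy)$ and involution $\overline{x+e\cdot y}=\bar x-e\cdot y$; the norm is $N(x)=x\bar x$. A quaternion division algebra over a field $K$ is a $K$-algebra isomorphic to $(E,b)$, where $E/K$ is a separable quadratic field extension with its non-trivial Galois automorphism as involution and $b\in K^*\setminus N(E)$. An octonion division algebra over $K$ is a $K$-algebra isomorphic to $(H,c)$, where $H$ is a quaternion division algebra over $K$ and $c\in K^*\setminus N(H)$; the resulting involution of the octonion algebra is its standard involution $\sigma_s\colon x\mapsto\bar x$. Let $\mathbb O$ be an octonion division algebra over $K$, with bilinear form $\langle x,y\rangle=x\bar y+y\bar x$. Let $\mathrm{Aut}(\mathbb O)$ be the group of its (not necessarily $K$-linear) ring automorphisms, and let $\mathrm{Aut}_J(\mathbb O)$ be the group, under composition, of all additive bijections $\gamma\colon\mathbb O\to\mathbb O$ with $\gamma(1)=1$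 and $\gamma(xyx)=\gamma(x)\gamma(y)\gamma(x)$ for all $x,y\in\mathbb O$. For a quaternion subalgebra $\mathbb H$ of $\mathbb O$, i.e. a $K$-subalgebra that is a quaternion division algebra over $K$, and elements $0\ne e\in\mathbb H^\perp$, $0\ne w\in\mathbb H$, we have $\mathbb O=\mathbb H\oplus e\cdot\mathbb H$; let $$\psi_{(\mathbb H,e,w)}\colon\mathbb O\to\mathbb O,\qquad x+e\cdot y\mapsto x+e\cdot(w^{-1}yw)\qquad(x,y\in\mathbb H),$$ let $\Psi$ be the set of all these maps, and let $\Gamma=\{\psi\circ\varphi\mid\psi\in\Psi,\ \varphi\in\mathrm{Aut}(\mathbb O)\}$. Then $\sigma_s$ is a central element of $\mathrm{Aut}_J(\mathbb O)$, the set $\Gamma$ is a subgroup of $\mathrm{Aut}_J(\mathbb O)$, and $$\mathrm{Aut}_J(\mathbb O)=\langle\sigma_s,\Gamma\rangle\cong\langle\sigma_s\rangle\times\Gamma,$$ where the isomorphism is given by multiplication, $\langle\sigma_s\rangle\times\Gamma\to\langle\sigma_s,\Gamma\rangle$, $(a,g)\mapsto ag$. -/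

import Mathlib

/-- A `K`-linear involution (anti-automorphism of order at most two) of a not necessarily
associative unital `K`-algebra `A`. -/
structure Involution (K A : Type*) [CommRing K] [NonAssocRing A] [Module K A]
    extends A →ₗ[K] A where
  map_mul' : ∀ x y : A, toFun (x * y) = toFun y * toFun x
  involutive' : ∀ x : A, toFun (toFun x) = x

namespace Involution

variable {K A : Type*} [CommRing K] [NonAssocRing A] [Module K A]

instance : FunLike (Involution K A) A A where
  coe σ := σ.toLinearMap
  coe_injective σ τ h := by
    cases σ
    cases τ
    congr
    exact DFunLike.coe_injective h

theorem map_add (σ : Involution K A) (x y : A) : σ (x + y) = σ x + σ y :=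
  σ.toLinearMap.map_add x y

theorem map_smul (σ : Involution K A) (k : K) (x : A) : σ (k • x) = k • σ x :=
  σ.toLinearMap.map_smul k x

theorem map_zero (σ : Involution K A) : σ 0 = 0 :=
  σ.toLinearMap.map_zero

theorem map_neg (σ : Involution K A) (x : A) : σ (-x) = -σ x :=
  σ.toLinearMap.map_neg x

theorem map_mul (σ : Involution K A) (x y : A) : σ (x * y) = σ y * σ x :=
  σ.map_mul' x y

theorem involutive (σ : Involution K A) (x : A) : σ (σ x) = x :=
  σ.involutive' x

theorem map_one (σ : Involution K A) : σ 1 = 1 := by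
  have h := σ.map_mul (σ 1) 1
  rw [mul_one, σ.involutive, mul_one] at h
  exact h.symm

/-- `β` is a value of the norm `x ↦ x * σ x`. -/
def IsNormValue (σ : Involution K A) (β : K) : Prop :=
  ∃ x : A, x * σ x = β • (1 : A)

end Involution

/-- The double `(A, β)` of an algebra `A` with involution `σ` (written `x ↦ x̄` below): the pair
`(x, y)` stands for `x + e · y`, that is, for the matrix with rows `(x, β ȳ)` and `(y, x̄)`. -/
def Doubling {K A : Type*} [CommRing K] [NonAssocRing A] [Module K A]
    (_σ : Involution K A) (_β : K) : Type _ :=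
  A × A

namespace Doubling

variable {K A : Type*} [CommRing K] [NonAssocRing A] [Module K A]
  {σ : Involution K A} {β : K}

instance : AddCommGroup (Doubling σ β) := inferInstanceAs (AddCommGroup (A × A))

instance : Module K (Doubling σ β) := inferInstanceAs (Module K (A × A))

/-- The element `x + e · y`. -/
def mk (x y : A) : Doubling σ β := (x, y)

/-- The component `x` of `x + e · y`. -/
def fst (z : Doubling σ β) : A := Prod.fst z

/-- The component `y` of `x + e · y`. -/
def snd (z : Doubling σ β) : A := Prod.snd z

/-- `(x + e · y) (u + e · v) = (x u + β (v ȳ)) + e · (x̄ v + u y)`. -/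
instance : Mul (Doubling σ β) where
  mul z t := mk (z.fst * t.fst + β • (t.snd * σ z.snd)) (σ z.fst * t.snd + t.fst * z.snd)

instance : One (Doubling σ β) where
  one := mk 1 0

@[ext]
theorem ext {z t : Doubling σ β} (h₁ : z.fst = t.fst) (h₂ : z.snd = t.snd) : z = t :=
  Prod.ext h₁ h₂

@[simp] theorem fst_mk (x y : A) : (mk x y : Doubling σ β).fst = x := rfl
@[simp] theorem snd_mk (x y : A) : (mk x y : Doubling σ β).snd = y := rfl
@[simp] theorem fst_zero : (0 : Doubling σ β).fst = 0 := rfl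
@[simp] theorem snd_zero : (0 : Doubling σ β).snd = 0 := rfl
@[simp] theorem fst_one : (1 : Doubling σ β).fst = 1 := rfl
@[simp] theorem snd_one : (1 : Doubling σ β).snd = 0 := rfl
@[simp] theorem fst_add (z t : Doubling σ β) : (z + t).fst = z.fst + t.fst := rfl
@[simp] theorem snd_add (z t : Doubling σ β) : (z + t).snd = z.snd + t.snd := rfl
@[simp] theorem fst_neg (z : Doubling σ β) : (-z).fst = -z.fst := rfl
@[simp] theorem snd_neg (z : Doubling σ β) : (-z).snd = -z.snd := rfl
@[simp] theorem fst_smul (k : K) (z : Doubling σ β) : (k • z).fst = k • z.fst := rfl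
@[simp] theorem snd_smul (k : K) (z : Doubling σ β) : (k • z).snd = k • z.snd := rfl
@[simp] theorem fst_mul (z t : Doubling σ β) :
    (z * t).fst = z.fst * t.fst + β • (t.snd * σ z.snd) := rfl
@[simp] theorem snd_mul (z t : Doubling σ β) :
    (z * t).snd = σ z.fst * t.snd + t.fst * z.snd := rfl

instance : NonAssocRing (Doubling σ β) :=
  { (inferInstance : AddCommGroup (Doubling σ β)) with
    left_distrib := fun z t r => by
      ext <;> simp [mul_add, add_mul] <;> abel
    right_distrib := fun z t r => by
      ext <;> simp [mul_add, add_mul, Involution.map_add] <;> abel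
    zero_mul := fun z => by ext <;> simp [Involution.map_zero]
    mul_zero := fun z => by ext <;> simp
    one_mul := fun z => by ext <;> simp [Involution.map_zero, Involution.map_one]
    mul_one := fun z => by ext <;> simp }

/-- The standard involution `x + e · y ↦ x̄ - e · y` of the double. -/
def conj (σ : Involution K A) (β : K) : Involution K (Doubling σ β) where
  toFun z := mk (σ z.fst) (-z.snd)
  map_add' z t := by
    ext
    · simp [Involution.map_add]
    · simp [add_comm]
  map_smul' k z := by ext <;> simp [Involution.map_smul]
  map_mul' z t := by
    ext
    · simp [Involution.map_add, Involution.map_mul, Involution.map_smul, Involution.map_neg,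
        Involution.involutive]
    · simp [Involution.involutive, add_comm]
  involutive' z := by ext <;> simp [Involution.involutive]

end Doubling

universe u v

/-- The data from which a quaternion division algebra `(E/K, b)` over `K` is built: a separable
quadratic extension `E/K`, the non-trivial element `σ` of its Galois group, and an element `b` of
`K` which is non-zero and not a norm from `E`. -/
structure QuaternionData (K : Type u) [Field K] : Type (max u (v + 1)) where
  E : Type v
  [field : Field E]
  [algebra : Algebra K E]
  separable : Algebra.IsSeparable K E
  finrank_eq : Module.finrank K E = 2
  σ : Involution K E
  σ_nontrivial : ∃ x : E, σ x ≠ x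
  b : K
  b_ne_zero : b ≠ 0
  b_not_norm : ¬ σ.IsNormValue b

attribute [instance] QuaternionData.field QuaternionData.algebra

namespace QuaternionData

variable {K : Type u} [Field K]

/-- The quaternion division algebra `(E/K, b)`. -/
abbrev Alg (D : QuaternionData.{u, v} K) : Type v := Doubling D.σ D.b

/-- The standard involution of `(E/K, b)`. -/
abbrev conj (D : QuaternionData.{u, v} K) : Involution K D.Alg := Doubling.conj D.σ D.b

end QuaternionData

/-- `A` is a quaternion division algebra over `K`: it is isomorphic, as a `K`-algebra, to some
`(E/K, b)`. -/
def IsQuaternionDivisionAlgebra (K : Type u) (A : Type v) [Field K] [NonUnitalNonAssocRing A]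
    [Module K A] : Prop :=
  ∃ (D : QuaternionData.{u, v} K) (f : A ≃ₗ[K] D.Alg), ∀ x y : A, f (x * y) = f x * f y

/-- An octonion division algebra over `K`: an algebra `O` together with an isomorphism of
`K`-algebras onto `(H, c)`, where `H` is a quaternion division algebra over `K` and the element
`c` of `K` is non-zero and not a norm from `H`. -/
structure OctonionDivisionAlgebra (K : Type u) (O : Type v) [Field K] [NonAssocRing O]
    [Module K O] : Type (max u (v + 1)) where
  H : QuaternionData.{u, v} K
  c : K
  c_ne_zero : c ≠ 0
  c_not_norm : ¬ H.conj.IsNormValue c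
  equiv : O ≃ₗ[K] Doubling H.conj c
  map_mul : ∀ x y : O, equiv (x * y) = equiv x * equiv y

namespace OctonionDivisionAlgebra

variable {K : Type u} {O : Type v} [Field K] [NonAssocRing O] [Module K O]

/-- The standard involution `σ_s` of `O`. -/
def conj (P : OctonionDivisionAlgebra K O) (x : O) : O :=
  P.equiv.symm (Doubling.conj P.H.conj P.c (P.equiv x))

/-- The bilinear form `⟨x, y⟩ = x ȳ + y x̄` associated with the norm `N(x) = x x̄`; its values lie
in `K · 1`. -/
def bilin (P : OctonionDivisionAlgebra K O) (x y : O) : O :=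
  x * P.conj y + y * P.conj x

/-- `ψ` is the map `ψ_(H, e, w) : x + e · y ↦ x + e · (w⁻¹ y w)`, for `x, y ∈ H`, where `H` is a
quaternion subalgebra, `e` is a non-zero element of the orthogonal complement of `H` and `w` is a
non-zero element of `H`, with inverse `w'`. As `O = H ⊕ e · H`, the formula determines `ψ`. -/
structure IsPsi (P : OctonionDivisionAlgebra K O) (H : NonUnitalSubalgebra K O) (e w : O)
    (ψ : O → O) : Prop where
  one_mem : (1 : O) ∈ H
  quaternion : IsQuaternionDivisionAlgebra K H
  e_ne_zero : e ≠ 0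
  e_orthogonal : ∀ x ∈ H, P.bilin e x = 0
  w_mem : w ∈ H
  w_ne_zero : w ≠ 0
  apply_eq : ∃ w' ∈ H, w * w' = 1 ∧ w' * w = 1 ∧
    ∀ x ∈ H, ∀ y ∈ H, ψ (x + e * y) = x + e * ((w' * y) * w)

/-- The set `Ψ` of all maps `ψ_(H, e, w)`. -/
def Psi (P : OctonionDivisionAlgebra K O) : Set (O → O) :=
  {ψ | ∃ (H : NonUnitalSubalgebra K O) (e w : O), P.IsPsi H e w ψ}

/-- The set `Γ` of all maps `ψ ∘ φ` with `ψ ∈ Ψ` and `φ` a ring automorphism of `O`. -/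
def Gamma (P : OctonionDivisionAlgebra K O) : Set (O → O) :=
  {γ | ∃ ψ ∈ P.Psi, ∃ φ : O ≃+* O, γ = ψ ∘ φ}

end OctonionDivisionAlgebra

/-- The group `Aut_J(O)` of Jordan automorphisms: additive bijections `γ` with `γ 1 = 1` and
`γ (x y x) = γ x γ y γ x`. The group law is composition. -/
def jordanAut (O : Type v) [NonAssocRing O] : Subgroup (Equiv.Perm O) where
  carrier := {γ | (∀ x y : O, γ (x + y) = γ x + γ y) ∧ γ 1 = 1 ∧
    ∀ x y : O, γ (x * y * x) = γ x * γ y * γ x}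
  mul_mem' := by
    rintro γ δ ⟨h₀, h₁, h₂⟩ ⟨k₀, k₁, k₂⟩
    refine ⟨fun x y => ?_, ?_, fun x y => ?_⟩
    · simp only [Equiv.Perm.mul_apply, k₀, h₀]
    · rw [Equiv.Perm.mul_apply, k₁, h₁]
    · simp only [Equiv.Perm.mul_apply, k₂, h₂]
  one_mem' := ⟨fun _ _ => rfl, rfl, fun _ _ => rfl⟩
  inv_mem' := by
    rintro γ ⟨h₀, h₁, h₂⟩
    have hi : ∀ z : O, γ (γ⁻¹ z) = z := γ.apply_symm_apply
    refine ⟨fun x y => γ.injective ?_, γ.injective ?_, fun x y => γ.injective ?_⟩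
    · simp only [h₀, hi]
    · rw [hi, h₁]
    · simp only [h₂, hi]

/-! Call `γ` an isotopy with parameter `a` if `γ (x y) = (γ x · a⁻¹)(a · γ y)`. The Moufang
identities give every additive isotopy bijection fixing `1` the Jordan property, and the isotopies
form a subgroup `isotopyGroup`. This subgroup is `Γ`: the map `ψ_(H, e, w)` is an isotopy with
parameter `w⁻¹` (`exists_isotopic_of_isPsi`). Conversely every `a` lies in a quaternion subalgebra
(`exists_quaternion_subalgebra_mem`), so an isotopy with parameter `a` differs from some `ψ_(H, e,
a⁻¹)` only by a ring automorphism.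

A Jordan automorphism is rigid for the quadratic structure. The square of a commutator is a Jordan
expression and there are no zero divisors, so commuting pairs, and with them the centre `K`, are
preserved. It follows that `γ` is semilinear (`jordan_smul`) and respects trace and norm up to the
induced map on `K` (`jordan_tr_nm`). Hence it commutes with `σ_s`, which is therefore central.

For generation, conjugation by an element `v` of trace zero is an isotopy, and following it by `σ_s`
gives the orthogonal reflection in `v` (`exists_reflection`). Composing `γ` with four
transformations, each the identity or such a reflection, makes it multiplicative on a quaternion
subalgebra `H = ⟨1, u, j, ju⟩` and on the products `e · H`, hence an automorphism
(`generated_eq_top`). The product is direct because `σ_s` squares to `1` and is not an isotopy: if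
it were, `O` would be commutative (`conjJordan_notMem`). -/

/-! ### Doubles: scalar-valued norms and anisotropy. -/

namespace Doubling

variable {K A : Type*} [CommRing K] [NonAssocRing A] [Module K A]
  {σ : Involution K A} {β : K}

@[simp] theorem fst_conj (z : Doubling σ β) : (conj σ β z).fst = σ z.fst := rfl
@[simp] theorem fst_sub (z t : Doubling σ β) : (z - t).fst = z.fst - t.fst := rfl
@[simp] theorem snd_conj (z : Doubling σ β) : (conj σ β z).snd = -z.snd := rfl

instance [IsScalarTower K A A] [SMulCommClass K A A] :
    IsScalarTower K (Doubling σ β) (Doubling σ β) where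
  smul_assoc k z t := by
    ext <;> simp [Involution.map_smul, smul_add, smul_mul_assoc, mul_smul_comm, smul_comm k β]

instance [IsScalarTower K A A] [SMulCommClass K A A] :
    SMulCommClass K (Doubling σ β) (Doubling σ β) where
  smul_comm k z t := by
    ext <;> simp [smul_add, smul_mul_assoc, mul_smul_comm, smul_comm k β]

end Doubling

namespace Involution

variable {K A : Type*} [CommRing K] [NonAssocRing A] [Module K A]

/-- The trace and the norm of the involution take values in `K`. -/
structure IsScalar (σ : Involution K A) : Prop where
  trace : ∀ x, ∃ t : K, x + σ x = t • (1 : A)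
  norm : ∀ x, ∃ n : K, x * σ x = n • (1 : A) ∧ σ x * x = n • (1 : A)

/-- The norm does not vanish on non-zero elements. -/
def IsAnisotropic (σ : Involution K A) : Prop := ∀ x, x * σ x = 0 → x = 0

theorem IsScalar.doubling {σ : Involution K A} (h : σ.IsScalar) (β : K) :
    (Doubling.conj σ β).IsScalar where
  trace z := by
    obtain ⟨t, ht⟩ := h.trace z.fst
    exact ⟨t, Doubling.ext (by simpa using ht) (by simp)⟩
  norm z := by
    obtain ⟨n, hn, hn'⟩ := h.norm z.fst
    obtain ⟨m, hm, hm'⟩ := h.norm z.snd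
    refine ⟨n - β * m, Doubling.ext ?_ ?_, Doubling.ext ?_ ?_⟩
    · simp [hn, hm, _root_.sub_smul, SemigroupAction.mul_smul, ← sub_eq_add_neg]
    · simp
    · simp [hn', hm, map_neg, _root_.sub_smul, SemigroupAction.mul_smul, ← sub_eq_add_neg]
    · simp [involutive]

end Involution

/-- The norm of `x + e y` is `N(x) - β N(y)`. If it vanishes with `y ≠ 0`, associativity makes `β`
the norm of `x y⁻¹`. -/
theorem Involution.IsAnisotropic.doubling {K A : Type*} [Field K] [NonAssocRing A] [Module K A]
    [IsScalarTower K A A] [SMulCommClass K A A] {σ : Involution K A}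
    (hs : σ.IsScalar) (hσ : σ.IsAnisotropic)
    (assoc : ∀ x y z : A, x * y * z = x * (y * z)) {β : K} (hβ : ¬ σ.IsNormValue β) :
    (Doubling.conj σ β).IsAnisotropic := by
  intro z hz
  have h1 : z.fst * σ z.fst = β • (z.snd * σ z.snd) := by
    have := congrArg Doubling.fst hz
    simpa [← sub_eq_add_neg, sub_eq_zero] using this
  have hy : z.snd = 0 := by
    by_contra hy
    obtain ⟨m, hm, hm'⟩ := hs.norm z.snd
    have hm0 : m ≠ 0 := by
      rintro rfl
      exact hy (hσ _ (by simpa using hm))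
    -- This witness is `x y⁻¹`, because `y⁻¹ = N(y)⁻¹ ȳ`.
    refine hβ ⟨m⁻¹ • (z.fst * σ z.snd), ?_⟩
    rw [σ.map_smul, σ.map_mul, σ.involutive, smul_mul_assoc, mul_smul_comm, assoc,
      ← assoc (σ z.snd), hm', smul_mul_assoc, one_mul, mul_smul_comm, h1, hm]
    simp only [smul_smul]
    congr 1
    field_simp
  have hx : z.fst = 0 := hσ _ (by rw [h1, hy]; simp)
  exact Doubling.ext hx hy

/-! ### Quaternion division algebras. -/

namespace QuaternionData

variable {K : Type u} [Field K] (D : QuaternionData.{u, v} K)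

theorem σ_mul (x y : D.E) : D.σ (x * y) = D.σ x * D.σ y := by
  rw [D.σ.map_mul, mul_comm]

theorem σ_algebraMap (k : K) : D.σ (algebraMap K D.E k) = algebraMap K D.E k := by
  rw [Algebra.algebraMap_eq_smul_one, D.σ.map_smul, D.σ.map_one]

theorem exists_linear {x : D.E} (hx : ∀ k : K, x ≠ k • 1) (y : D.E) :
    ∃ a b : K, y = a • 1 + b • x := by
  have : Module.Finite K D.E := Module.finite_of_finrank_eq_succ D.finrank_eq
  have hli : LinearIndependent K ![1, x] := by
    rw [LinearIndependent.pair_iff]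
    intro s t h
    have ht : t = 0 := by
      by_contra ht
      apply hx (-(t⁻¹ * s))
      rw [neg_smul, mul_smul, eq_neg_iff_add_eq_zero, ← smul_right_injective D.E ht |>.eq_iff]
      simp only [smul_add, smul_smul, mul_inv_cancel_left₀ ht, smul_zero]
      rw [add_comm, h]
    subst ht
    simpa using h
  have hspan := hli.span_eq_top_of_card_eq_finrank (by simp [D.finrank_eq])
  have hy' : y ∈ Submodule.span K (Set.range ![1, x]) := hspan ▸ Submodule.mem_top
  simp only [Matrix.range_cons, Matrix.range_empty, Set.union_empty, Set.singleton_union,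
    Submodule.mem_span_pair] at hy'
  obtain ⟨a, b, rfl⟩ := hy'
  exact ⟨a, b, rfl⟩

/-- A fixed `x` outside `K` would form a basis together with `1`, and then `σ` would be the
identity. -/
theorem exists_smul_one_of_fixed {x : D.E} (hx : D.σ x = x) : ∃ k : K, x = k • 1 := by
  by_contra! hne
  obtain ⟨y, hy⟩ := D.σ_nontrivial
  obtain ⟨a, b, rfl⟩ := D.exists_linear hne y
  exact hy (by rw [D.σ.map_add, D.σ.map_smul, D.σ.map_smul, D.σ.map_one, hx])

theorem σ_isScalar : D.σ.IsScalar where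
  trace x := D.exists_smul_one_of_fixed (by
    rw [D.σ.map_add, D.σ.involutive, add_comm])
  norm x := by
    obtain ⟨k, hk⟩ := D.exists_smul_one_of_fixed (x := x * D.σ x) (by
      rw [D.σ.map_mul, D.σ.involutive])
    exact ⟨k, hk, by rw [mul_comm, hk]⟩

theorem σ_eq_zero {x : D.E} (h : D.σ x = 0) : x = 0 := by
  rw [← D.σ.involutive x, h, D.σ.map_zero]

theorem σ_isAnisotropic : D.σ.IsAnisotropic := by
  intro x hx
  rcases mul_eq_zero.1 hx with h | h
  · exact h
  · exact D.σ_eq_zero h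

theorem conj_isScalar : D.conj.IsScalar := D.σ_isScalar.doubling D.b

theorem mul_assoc (x y z : D.Alg) : x * y * z = x * (y * z) := by
  refine Doubling.ext ?_ ?_ <;>
  simp only [Doubling.fst_mul, Doubling.snd_mul, Involution.map_add, D.σ_mul, Algebra.smul_def,
    D.σ_algebraMap, Involution.involutive] <;> ring

theorem conj_isAnisotropic : D.conj.IsAnisotropic :=
  D.σ_isAnisotropic.doubling D.σ_isScalar _root_.mul_assoc D.b_not_norm

theorem finrank_alg : Module.finrank K D.Alg = 4 := by
  have : Module.Finite K D.E := Module.finite_of_finrank_eq_succ D.finrank_eq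
  have : Module.finrank K (D.E × D.E) = 4 := by
    rw [Module.finrank_prod, D.finrank_eq]
  exact this

instance finite_alg : Module.Finite K D.Alg :=
  Module.finite_of_finrank_eq_succ D.finrank_alg

theorem not_commutative : ∃ x y : D.Alg, x * y ≠ y * x := by
  obtain ⟨x, hx⟩ := D.σ_nontrivial
  refine ⟨Doubling.mk x 0, Doubling.mk 0 1, fun h => hx ?_⟩
  simpa [Involution.map_zero] using congrArg Doubling.snd h

end QuaternionData

/-! ### Octonions: Moufang identities, trace, norm and polar form. -/

namespace OctonionDivisionAlgebra

variable {K : Type u} {O : Type v} [Field K] [NonAssocRing O] [Module K O]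
  (P : OctonionDivisionAlgebra K O)

theorem smul_mul (P : OctonionDivisionAlgebra K O) (k : K) (x y : O) : (k • x) * y = k • (x * y) :=
  P.equiv.injective (by simp only [P.map_mul, map_smul, smul_mul_assoc])

theorem mul_smul (P : OctonionDivisionAlgebra K O) (k : K) (x y : O) : x * (k • y) = k • (x * y) :=
  P.equiv.injective (by simp only [P.map_mul, map_smul, mul_smul_comm])

theorem map_one : P.equiv 1 = 1 := by
  have h := P.map_mul 1 (P.equiv.symm 1)
  rw [one_mul, P.equiv.apply_symm_apply, mul_one] at h
  exact h.symm

theorem equiv_conj (x : O) : P.equiv (P.conj x) = Doubling.conj P.H.conj P.c (P.equiv x) := by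
  simp [conj]

theorem conj_add (x y : O) : P.conj (x + y) = P.conj x + P.conj y :=
  P.equiv.injective (by simp only [equiv_conj, map_add, Involution.map_add])

theorem conj_smul (k : K) (x : O) : P.conj (k • x) = k • P.conj x :=
  P.equiv.injective (by simp only [equiv_conj, map_smul, Involution.map_smul])

theorem conj_mul (x y : O) : P.conj (x * y) = P.conj y * P.conj x :=
  P.equiv.injective (by simp only [equiv_conj, P.map_mul, Involution.map_mul])

theorem conj_conj (x : O) : P.conj (P.conj x) = x :=
  P.equiv.injective (by simp only [equiv_conj, Involution.involutive])

theorem conj_one : P.conj 1 = 1 :=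
  P.equiv.injective (by simp only [equiv_conj, P.map_one, Involution.map_one])

theorem exists_trace (x : O) : ∃ t : K, x + P.conj x = t • (1 : O) := by
  obtain ⟨t, ht⟩ := (P.H.conj_isScalar.doubling P.c).trace (P.equiv x)
  exact ⟨t, P.equiv.injective (by simpa [equiv_conj, P.map_one] using ht)⟩

theorem exists_norm (x : O) :
    ∃ n : K, x * P.conj x = n • (1 : O) ∧ P.conj x * x = n • (1 : O) := by
  obtain ⟨n, hn, hn'⟩ := (P.H.conj_isScalar.doubling P.c).norm (P.equiv x)
  exact ⟨n, P.equiv.injective (by simpa [equiv_conj, P.map_one, P.map_mul] using hn),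
    P.equiv.injective (by simpa [equiv_conj, P.map_one, P.map_mul] using hn')⟩

theorem eq_zero_of_mul_conj {x : O} (h : x * P.conj x = 0) : x = 0 := by
  have := (P.H.conj_isAnisotropic.doubling P.H.conj_isScalar P.H.mul_assoc P.c_not_norm)
    (P.equiv x) (by rw [← equiv_conj, ← P.map_mul, h, map_zero])
  simpa using this

theorem finrank_eq (P : OctonionDivisionAlgebra K O) : Module.finrank K O = 8 := by
  have : Module.finrank K (P.H.Alg × P.H.Alg) = 8 := by
    rw [Module.finrank_prod, P.H.finrank_alg]
  rw [P.equiv.finrank_eq]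
  exact this

theorem finite (P : OctonionDivisionAlgebra K O) :
    Module.Finite K O := Module.finite_of_finrank_eq_succ P.finrank_eq

set_option maxHeartbeats 1000000 in
-- Unfolding both doublings leaves four coordinates in the commutative field `E`, where the claim is
-- a polynomial identity in the coordinates and their conjugates. The next identities are checked in
-- the same way.
theorem left_moufang (P : OctonionDivisionAlgebra K O)
    (x y z : O) : x * (y * (x * z)) = (x * y * x) * z := by
  apply P.equiv.injective
  refine Doubling.ext (Doubling.ext ?_ ?_) (Doubling.ext ?_ ?_) <;>
  simp only [P.map_mul, Doubling.fst_mul, Doubling.snd_mul, Doubling.fst_add,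
    Doubling.snd_add, Doubling.fst_smul, Doubling.snd_smul, Doubling.fst_conj, Doubling.snd_conj,
    Involution.map_add, Involution.map_neg, P.H.σ_mul, Algebra.smul_def,
    P.H.σ_algebraMap, Involution.involutive] <;> ring

set_option maxHeartbeats 1000000 in
theorem middle_moufang (P : OctonionDivisionAlgebra K O)
    (x y z : O) : (x * y) * (z * x) = x * (y * z) * x := by
  apply P.equiv.injective
  refine Doubling.ext (Doubling.ext ?_ ?_) (Doubling.ext ?_ ?_) <;>
  simp only [P.map_mul, Doubling.fst_mul, Doubling.snd_mul, Doubling.fst_add,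
    Doubling.snd_add, Doubling.fst_smul, Doubling.snd_smul, Doubling.fst_conj, Doubling.snd_conj,
    Involution.map_add, Involution.map_neg, P.H.σ_mul, Algebra.smul_def,
    P.H.σ_algebraMap, Involution.involutive] <;> ring

set_option maxHeartbeats 1000000 in
theorem add_conj_assoc (x y z : O) :
    x * y * z + P.conj (x * y * z) = x * (y * z) + P.conj (x * (y * z)) := by
  apply P.equiv.injective
  refine Doubling.ext (Doubling.ext ?_ ?_) (Doubling.ext ?_ ?_) <;>
  simp only [P.map_mul, map_add, P.equiv_conj, Doubling.fst_mul, Doubling.snd_mul, Doubling.fst_add,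
    Doubling.snd_add, Doubling.fst_smul, Doubling.snd_smul, Doubling.fst_conj, Doubling.snd_conj,
    Doubling.snd_neg, Doubling.fst_neg,
    Involution.map_add, Involution.map_neg, P.H.σ_mul, Algebra.smul_def,
    P.H.σ_algebraMap, Involution.involutive] <;> ring

set_option maxHeartbeats 1000000 in
theorem add_conj_comm (x y : O) : x * y + P.conj (x * y) = y * x + P.conj (y * x) := by
  apply P.equiv.injective
  refine Doubling.ext (Doubling.ext ?_ ?_) (Doubling.ext ?_ ?_) <;>
  simp only [P.map_mul, map_add, P.equiv_conj, Doubling.fst_mul, Doubling.snd_mul, Doubling.fst_add,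
    Doubling.snd_add, Doubling.fst_smul, Doubling.snd_smul, Doubling.fst_conj, Doubling.snd_conj,
    Doubling.snd_neg, Doubling.fst_neg,
    Involution.map_add, Involution.map_neg, P.H.σ_mul, Algebra.smul_def,
    P.H.σ_algebraMap, Involution.involutive] <;> ring

set_option maxHeartbeats 1000000 in
theorem mul_conj_mul (x y : O) :
    x * y * P.conj (x * y) = (x * P.conj x) * (y * P.conj y) := by
  apply P.equiv.injective
  refine Doubling.ext (Doubling.ext ?_ ?_) (Doubling.ext ?_ ?_) <;>
  simp only [P.map_mul, P.equiv_conj, Doubling.fst_mul, Doubling.snd_mul, Doubling.fst_add,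
    Doubling.snd_add, Doubling.fst_smul, Doubling.snd_smul, Doubling.fst_conj, Doubling.snd_conj,
    Doubling.snd_neg, Doubling.fst_neg,
    Involution.map_add, Involution.map_neg, P.H.σ_mul, Algebra.smul_def,
    P.H.σ_algebraMap, Involution.involutive] <;> ring

theorem flexible (P : OctonionDivisionAlgebra K O) (x y : O) : x * (y * x) = x * y * x := by
  simpa using P.middle_moufang x 1 y

theorem left_alternative (P : OctonionDivisionAlgebra K O) (x y : O) : x * (x * y) = x * x * y := by
  simpa using P.left_moufang x 1 y

theorem right_moufang (P : OctonionDivisionAlgebra K O)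
    (x y z : O) : z * x * y * x = z * (x * y * x) := by
  have h := congrArg P.conj (P.left_moufang (P.conj x) (P.conj y) (P.conj z))
  simpa only [P.conj_mul, P.conj_conj, P.flexible] using h

theorem right_alternative (P : OctonionDivisionAlgebra K O)
    (x y : O) : y * x * x = y * (x * x) := by
  simpa using P.right_moufang x 1 y

theorem nontrivial (P : OctonionDivisionAlgebra K O) : Nontrivial O :=
  Module.nontrivial_of_finrank_pos (R := K) (by rw [P.finrank_eq]; norm_num)

theorem smul_one_injective (P : OctonionDivisionAlgebra K O)
    {k l : K} (h : k • (1 : O) = l • 1) : k = l :=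
  have := P.nontrivial
  smul_left_injective K (one_ne_zero (α := O)) h

theorem smul_one_mul (P : OctonionDivisionAlgebra K O)
    (k : K) (x : O) : (k • (1 : O)) * x = k • x := by
  rw [P.smul_mul, one_mul]

theorem mul_smul_one (P : OctonionDivisionAlgebra K O)
    (k : K) (x : O) : x * (k • (1 : O)) = k • x := by
  rw [P.mul_smul, mul_one]

/-- The trace `x + x̄`. -/
noncomputable def tr (P : OctonionDivisionAlgebra K O) (x : O) : K := (P.exists_trace x).choose

/-- The norm `x x̄`. -/
noncomputable def nm (P : OctonionDivisionAlgebra K O) (x : O) : K := (P.exists_norm x).choose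

/-- The polar form of the norm. -/
noncomputable def polar (P : OctonionDivisionAlgebra K O) (x y : O) : K := P.tr (x * P.conj y)

theorem add_conj (x : O) : x + P.conj x = P.tr x • (1 : O) := (P.exists_trace x).choose_spec

theorem mul_conj (x : O) : x * P.conj x = P.nm x • (1 : O) := (P.exists_norm x).choose_spec.1

theorem conj_mul_self (x : O) : P.conj x * x = P.nm x • (1 : O) :=
  (P.exists_norm x).choose_spec.2

theorem conj_eq (x : O) : P.conj x = P.tr x • (1 : O) - x := by
  rw [← P.add_conj]; abel

theorem bilin_eq (x y : O) : P.bilin x y = P.polar x y • (1 : O) := by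
  rw [polar, ← P.add_conj, P.conj_mul, P.conj_conj, bilin]

theorem tr_eq_of {x : O} {t : K} (h : x + P.conj x = t • (1 : O)) : P.tr x = t :=
  P.smul_one_injective (by rw [← P.add_conj, h])

theorem nm_eq_of {x : O} {t : K} (h : x * P.conj x = t • (1 : O)) : P.nm x = t :=
  P.smul_one_injective (by rw [← P.mul_conj, h])

theorem tr_add (x y : O) : P.tr (x + y) = P.tr x + P.tr y :=
  P.tr_eq_of (by rw [P.conj_add, add_smul, ← P.add_conj, ← P.add_conj]; abel)

theorem tr_smul (k : K) (x : O) : P.tr (k • x) = k * P.tr x :=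
  P.tr_eq_of (by rw [P.conj_smul, SemigroupAction.mul_smul, ← P.add_conj, smul_add])

theorem tr_neg (x : O) : P.tr (-x) = -P.tr x := by
  simpa using P.tr_smul (-1) x

theorem tr_sub (x y : O) : P.tr (x - y) = P.tr x - P.tr y := by
  rw [sub_eq_add_neg, P.tr_add, P.tr_neg, sub_eq_add_neg]

theorem tr_one : P.tr 1 = 2 :=
  P.tr_eq_of (by rw [P.conj_one, two_smul])

theorem tr_conj (x : O) : P.tr (P.conj x) = P.tr x :=
  P.tr_eq_of (by rw [P.conj_conj, add_comm, P.add_conj])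

theorem tr_comm (x y : O) : P.tr (x * y) = P.tr (y * x) :=
  P.tr_eq_of (by rw [P.add_conj_comm, P.add_conj])

theorem tr_assoc (x y z : O) : P.tr (x * y * z) = P.tr (x * (y * z)) :=
  P.tr_eq_of (by rw [P.add_conj_assoc, P.add_conj])

theorem nm_smul (k : K) (x : O) : P.nm (k • x) = k ^ 2 * P.nm x :=
  P.nm_eq_of (by rw [P.conj_smul, P.smul_mul, P.mul_smul, P.mul_conj, smul_smul,
    smul_smul, pow_two])

theorem nm_one : P.nm 1 = 1 := P.nm_eq_of (by rw [P.conj_one, one_smul, one_mul])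

theorem nm_mul (x y : O) : P.nm (x * y) = P.nm x * P.nm y :=
  P.nm_eq_of (by rw [P.mul_conj_mul, P.mul_conj, P.mul_conj, P.smul_one_mul, smul_smul])

theorem nm_conj (x : O) : P.nm (P.conj x) = P.nm x :=
  P.nm_eq_of (by rw [P.conj_conj, P.conj_mul_self])

theorem nm_eq_zero {x : O} : P.nm x = 0 ↔ x = 0 := by
  constructor
  · intro h
    exact P.eq_zero_of_mul_conj (by rw [P.mul_conj, h, zero_smul])
  · rintro rfl
    exact P.nm_eq_of (by rw [zero_mul, zero_smul])

theorem mul_self (x : O) : x * x = P.tr x • x - P.nm x • (1 : O) := by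
  rw [← P.mul_conj, P.conj_eq, mul_sub, P.mul_smul_one]; abel

theorem conj_mul_cancel (x y : O) : P.conj x * (x * y) = P.nm x • y := by
  rw [P.conj_eq, sub_mul, P.smul_one_mul, P.left_alternative, P.mul_self, sub_mul, P.smul_mul,
    P.smul_one_mul]; abel

theorem mul_conj_cancel_left (x y : O) : x * (P.conj x * y) = P.nm x • y := by
  simpa [P.conj_conj, P.nm_conj] using P.conj_mul_cancel (P.conj x) y

theorem mul_conj_cancel (x y : O) : y * x * P.conj x = P.nm x • y := by
  have := congrArg P.conj (P.mul_conj_cancel_left x (P.conj y))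
  simpa only [P.conj_mul, P.conj_conj, P.conj_smul] using this

theorem polar_comm (x y : O) : P.polar x y = P.polar y x := by
  rw [polar, ← P.tr_conj, P.conj_mul, P.conj_conj, polar]

theorem polar_add_left (x y z : O) : P.polar (x + y) z = P.polar x z + P.polar y z := by
  rw [polar, add_mul, P.tr_add]; rfl

theorem polar_smul_left (k : K) (x z : O) : P.polar (k • x) z = k * P.polar x z := by
  rw [polar, P.smul_mul, P.tr_smul]; rfl

theorem polar_add_right (x y z : O) : P.polar x (y + z) = P.polar x y + P.polar x z := by
  rw [P.polar_comm, P.polar_add_left, P.polar_comm y, P.polar_comm z]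

theorem polar_smul_right (k : K) (x z : O) : P.polar x (k • z) = k * P.polar x z := by
  rw [P.polar_comm, P.polar_smul_left, P.polar_comm]

theorem polar_sub_left (x y z : O) : P.polar (x - y) z = P.polar x z - P.polar y z := by
  rw [polar, sub_mul, P.tr_sub]; rfl

theorem polar_sub_right (x y z : O) : P.polar x (y - z) = P.polar x y - P.polar x z := by
  rw [P.polar_comm, P.polar_sub_left, P.polar_comm y, P.polar_comm z]

theorem polar_one_right (x : O) : P.polar x 1 = P.tr x := by
  rw [polar, P.conj_one, mul_one]

theorem polar_self (x : O) : P.polar x x = 2 * P.nm x := by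
  rw [polar, P.mul_conj, P.tr_smul, P.tr_one, mul_comm]

theorem nm_add (x y : O) : P.nm (x + y) = P.nm x + P.nm y + P.polar x y := by
  apply P.nm_eq_of
  rw [add_smul, add_smul, ← P.bilin_eq, ← P.mul_conj, ← P.mul_conj, P.conj_add, mul_add, add_mul,
    add_mul, bilin]
  abel

theorem polar_mul_left (x y z : O) : P.polar (x * y) z = P.polar x (z * P.conj y) := by
  rw [polar, P.tr_assoc, polar, P.conj_mul, P.conj_conj]

theorem polar_mul_left' (x y z : O) : P.polar (x * y) z = P.polar y (P.conj x * z) := by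
  rw [polar, P.tr_assoc, P.tr_comm, P.tr_assoc, polar, P.conj_mul, P.conj_conj]

theorem polar_mul_mul_left (x y z : O) : P.polar (x * y) (x * z) = P.nm x * P.polar y z := by
  rw [P.polar_mul_left', P.conj_mul_cancel, P.polar_smul_right]

theorem polar_mul_mul_right (x y z : O) : P.polar (x * z) (y * z) = P.nm z * P.polar x y := by
  rw [P.polar_mul_left, P.mul_conj_cancel, P.polar_smul_right]

/-- This is the polarisation of `x̄ (x z) = N(x) z`; it is the source of the rules for multiplying
orthogonal elements. -/
theorem conj_mul_add (x y z : O) :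
    P.conj x * (y * z) + P.conj y * (x * z) = P.polar x y • z := by
  have h := P.conj_mul_cancel (x + y) z
  simp only [P.nm_add, P.conj_add, add_mul, mul_add, P.conj_mul_cancel, add_smul] at h
  rw [← sub_eq_zero] at h ⊢
  rw [← h]
  abel

theorem mul_mul_conj_add (x y z : O) :
    z * x * P.conj y + z * y * P.conj x = P.polar x y • z := by
  have h := P.mul_conj_cancel (x + y) z
  simp only [P.nm_add, P.conj_add, add_mul, mul_add, P.mul_conj_cancel, add_smul] at h
  rw [← sub_eq_zero] at h ⊢
  rw [← h]
  abel

theorem exists_inv (P : OctonionDivisionAlgebra K O) {x : O} (hx : x ≠ 0) : ∃ y, x * y = 1 := by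
  have h : P.nm x ≠ 0 := fun h => hx (P.nm_eq_zero.1 h)
  exact ⟨(P.nm x)⁻¹ • P.conj x, by
    rw [P.mul_smul, P.mul_conj, smul_smul, inv_mul_cancel₀ h, one_smul]⟩

theorem ne_zero_of_mul_eq_one {x y : O} (h : x * y = 1) : P.nm x ≠ 0 := by
  intro h0
  have := P.nontrivial
  rw [P.nm_eq_zero.1 h0, zero_mul] at h
  exact zero_ne_one h

theorem inv_eq {x y : O} (h : x * y = 1) : y = (P.nm x)⁻¹ • P.conj x := by
  have h1 := P.conj_mul_cancel x y
  rw [h, mul_one] at h1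
  rw [h1, smul_smul, inv_mul_cancel₀ (P.ne_zero_of_mul_eq_one h), one_smul]

theorem inv_comm (P : OctonionDivisionAlgebra K O) {x y : O} (h : x * y = 1) : y * x = 1 := by
  rw [P.inv_eq h, P.smul_mul, P.conj_mul_self, smul_smul,
    inv_mul_cancel₀ (P.ne_zero_of_mul_eq_one h), one_smul]

theorem inv_cancel_left (P : OctonionDivisionAlgebra K O)
    {x y : O} (h : x * y = 1) (z : O) : y * (x * z) = z := by
  rw [P.inv_eq h, P.smul_mul, P.conj_mul_cancel, smul_smul,
    inv_mul_cancel₀ (P.ne_zero_of_mul_eq_one h), one_smul]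

theorem inv_cancel_right (P : OctonionDivisionAlgebra K O)
    {x y : O} (h : x * y = 1) (z : O) : z * x * y = z := by
  rw [P.inv_eq h, P.mul_smul, P.mul_conj_cancel, smul_smul,
    inv_mul_cancel₀ (P.ne_zero_of_mul_eq_one h), one_smul]

theorem eq_zero_or_eq_zero (P : OctonionDivisionAlgebra K O)
    {x y : O} (h : x * y = 0) : x = 0 ∨ y = 0 := by
  rw [← P.nm_eq_zero, ← P.nm_eq_zero (x := y), ← mul_eq_zero, ← P.nm_mul, h, P.nm_eq_zero]

/-- Commuting with some `t ∈ E` such that `σ t ≠ t` kills three of the four coordinates in `E`.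
Commuting with the generator of the inner double makes the remaining one `σ`-fixed. -/
theorem exists_smul_one_of_central (P : OctonionDivisionAlgebra K O)
    {z : O} (hz : ∀ x, z * x = x * z) : ∃ k : K, z = k • (1 : O) := by
  have key : ∀ w, P.equiv z * w = w * P.equiv z := fun w => by
    rw [← P.equiv.apply_symm_apply w, ← P.map_mul, hz, P.map_mul]
  obtain ⟨t, ht⟩ := P.H.σ_nontrivial
  have h1 := key (Doubling.mk (Doubling.mk t 0) 0)
  have h2 := key (Doubling.mk (Doubling.mk 0 1) 0)
  have h11 : t * (P.equiv z).fst.snd = P.H.σ t * (P.equiv z).fst.snd := by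
    simpa [Involution.map_zero] using congrArg (fun w => w.fst.snd) h1
  have h12 : t * (P.equiv z).snd.fst = P.H.σ t * (P.equiv z).snd.fst := by
    simpa [Involution.map_zero] using congrArg (fun w => w.snd.fst) h1
  have h13 : P.H.σ t * (P.equiv z).snd.snd = t * (P.equiv z).snd.snd := by
    simpa [Involution.map_zero, Involution.involutive] using congrArg (fun w => w.snd.snd) h1
  have h2' : P.H.σ (P.equiv z).fst.fst = (P.equiv z).fst.fst := by
    simpa [Involution.map_zero] using congrArg (fun w => w.fst.snd) h2
  have e1 : (P.equiv z).fst.snd = 0 := by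
    by_contra h
    exact ht (mul_right_cancel₀ h h11).symm
  have e2 : (P.equiv z).snd.fst = 0 := by
    by_contra h
    exact ht (mul_right_cancel₀ h h12).symm
  have e3 : (P.equiv z).snd.snd = 0 := by
    by_contra h
    exact ht (mul_right_cancel₀ h h13)
  obtain ⟨k, hk⟩ := P.H.exists_smul_one_of_fixed h2'
  refine ⟨k, P.equiv.injective ?_⟩
  rw [map_smul, P.map_one]
  exact Doubling.ext (Doubling.ext hk (by simpa using e1))
    (Doubling.ext (by simpa using e2) (by simpa using e3))

theorem not_commutative (P : OctonionDivisionAlgebra K O) : ∃ x y : O, x * y ≠ y * x := by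
  obtain ⟨x, y, h⟩ := P.H.not_commutative
  refine ⟨P.equiv.symm (Doubling.mk x 0), P.equiv.symm (Doubling.mk y 0), fun h' => h ?_⟩
  have := congrArg P.equiv h'
  simp only [P.map_mul, P.equiv.apply_symm_apply] at this
  simpa [Involution.map_zero] using congrArg Doubling.fst this

/-! ### Multiplication rules for orthogonal elements. -/

section Orthogonal

variable {e x y : O}

theorem conj_of_tr (he : P.tr e = 0) : P.conj e = -e := by
  rw [P.conj_eq, he, zero_smul, zero_sub]

theorem polar_conj_of_tr (he : P.tr e = 0) (hx : P.polar e x = 0) : P.polar e (P.conj x) = 0 := by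
  rw [P.conj_eq, P.polar_sub_right, P.polar_smul_right, P.polar_one_right, he, hx]; ring

theorem conj_mul_orth (he : P.tr e = 0) (hx : P.polar e x = 0) (y : O) :
    P.conj x * (e * y) = e * (x * y) := by
  have h := P.conj_mul_add x e y
  rwa [P.polar_comm, hx, zero_smul, P.conj_of_tr he, neg_mul, ← sub_eq_add_neg, sub_eq_zero] at h

/-- `x (e y) = e (x̄ y)` for `e` orthogonal to `1` and `x`. -/
theorem mul_orth (he : P.tr e = 0) (hx : P.polar e x = 0) (y : O) :
    x * (e * y) = e * (P.conj x * y) := by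
  have h := P.conj_mul_orth he (P.polar_conj_of_tr he hx) y
  rwa [P.conj_conj] at h

theorem orth_comm (he : P.tr e = 0) (hx : P.polar e x = 0) : e * x = P.conj x * e := by
  simpa using (P.conj_mul_orth he hx 1).symm

/-- `(e x) y = e (y x)` for `e` orthogonal to `1`, `x`, `y` and `y x`. -/
theorem orth_mul (he : P.tr e = 0) (hx : P.polar e x = 0) (hy : P.polar e y = 0)
    (hyx : P.polar e (y * x) = 0) : e * x * y = e * (y * x) := by
  have h := P.mul_mul_conj_add e (P.conj y) (P.conj x)
  rw [P.polar_conj_of_tr he hy, zero_smul, P.conj_conj, P.conj_of_tr he, mul_neg,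
    ← sub_eq_add_neg, sub_eq_zero] at h
  rw [P.orth_comm he hx, h, P.orth_comm he hyx, P.conj_mul]

/-- `(e x) (e y) = -N(e) (y x̄)` for `e` orthogonal to `1`, `y` and `x ȳ`. -/
theorem orth_mul_orth (he : P.tr e = 0) (hy : P.polar e y = 0)
    (hxy : P.polar e (x * P.conj y) = 0) :
    (e * x) * (e * y) = -P.nm e • (y * P.conj x) := by
  rw [P.orth_comm he hy, P.middle_moufang, P.orth_comm he hxy, P.right_alternative, P.mul_self,
    he, P.conj_mul, P.conj_conj, zero_smul, zero_sub, mul_neg, P.mul_smul_one, neg_smul]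

end Orthogonal

end OctonionDivisionAlgebra

/-! ### Jordan automorphisms: semilinearity, trace and norm. -/

namespace jordanAut

variable {O : Type v} [NonAssocRing O] (γ : jordanAut O)

theorem map_add (x y : O) : γ.1 (x + y) = γ.1 x + γ.1 y := γ.2.1 x y

theorem map_one : γ.1 1 = 1 := γ.2.2.1

theorem map_triple (x y : O) : γ.1 (x * y * x) = γ.1 x * γ.1 y * γ.1 x := γ.2.2.2 x y

theorem map_zero : γ.1 0 = 0 := by
  simpa using jordanAut.map_add γ 0 0

theorem map_neg (x : O) : γ.1 (-x) = -γ.1 x := by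
  rw [eq_neg_iff_add_eq_zero, ← jordanAut.map_add γ, neg_add_cancel, jordanAut.map_zero γ]

theorem map_sub (x y : O) : γ.1 (x - y) = γ.1 x - γ.1 y := by
  rw [sub_eq_add_neg, jordanAut.map_add γ, jordanAut.map_neg γ, sub_eq_add_neg]

theorem map_mul_self (x : O) : γ.1 (x * x) = γ.1 x * γ.1 x := by
  simpa [jordanAut.map_one γ] using jordanAut.map_triple γ x 1

theorem map_mul_add_mul (x y : O) :
    γ.1 (x * y + y * x) = γ.1 x * γ.1 y + γ.1 y * γ.1 x := by
  have h := jordanAut.map_mul_self γ (x + y)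
  simp only [add_mul, mul_add, jordanAut.map_add γ, jordanAut.map_mul_self γ] at h
  rw [jordanAut.map_add γ]
  rw [← sub_eq_zero] at h ⊢
  rw [← h]
  abel

theorem map_mul_swap {x y : O} (h : γ.1 (x * y) = γ.1 x * γ.1 y) :
    γ.1 (y * x) = γ.1 y * γ.1 x := by
  have h' := jordanAut.map_mul_add_mul γ x y
  rwa [jordanAut.map_add γ, h, add_right_inj] at h'

end jordanAut

namespace OctonionDivisionAlgebra

variable {K : Type u} {O : Type v} [Field K] [NonAssocRing O] [Module K O]
  (P : OctonionDivisionAlgebra K O)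

/-- By the middle Moufang identity `(x y)(y x) = x y² x`, so the mixed terms, and with them `[x,
y]²`, are expressible through squares, `x y + y x` and `x y x`. All of these are preserved by a
Jordan automorphism. -/
theorem commutator_mul_self (P : OctonionDivisionAlgebra K O) (x y : O) :
    (x * y - y * x) * (x * y - y * x) =
      (x * y + y * x) * (x * y + y * x) -
        ((x * (y * y) * x + y * (x * x) * y) + (x * (y * y) * x + y * (x * x) * y)) := by
  rw [← P.middle_moufang, ← P.middle_moufang, sub_mul, mul_sub, mul_sub, add_mul, mul_add, mul_add]
  abel

theorem jordan_commutator (P : OctonionDivisionAlgebra K O) (γ : jordanAut O) (x y : O) :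
    γ.1 ((x * y - y * x) * (x * y - y * x)) =
      (γ.1 x * γ.1 y - γ.1 y * γ.1 x) * (γ.1 x * γ.1 y - γ.1 y * γ.1 x) := by
  rw [P.commutator_mul_self, P.commutator_mul_self]
  simp only [jordanAut.map_sub γ, jordanAut.map_mul_self γ, jordanAut.map_mul_add_mul γ]
  simp only [jordanAut.map_add γ, jordanAut.map_triple γ, jordanAut.map_mul_self γ]

theorem jordan_commute (P : OctonionDivisionAlgebra K O)
    (γ : jordanAut O) {x y : O} (h : x * y = y * x) :
    γ.1 x * γ.1 y = γ.1 y * γ.1 x := by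
  have h' := P.jordan_commutator γ x y
  rw [h, sub_self, zero_mul, jordanAut.map_zero γ] at h'
  rw [← sub_eq_zero]
  exact (P.eq_zero_or_eq_zero h'.symm).elim id id

theorem exists_jordan_smul_one (P : OctonionDivisionAlgebra K O) (γ : jordanAut O) (k : K) :
    ∃ l : K, γ.1 (k • (1 : O)) = l • (1 : O) := by
  apply P.exists_smul_one_of_central
  intro x
  obtain ⟨y, rfl⟩ := γ.1.surjective x
  exact P.jordan_commute γ (by rw [P.smul_one_mul, P.mul_smul_one])

/-- The map that a Jordan automorphism induces on the ground field. -/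
noncomputable def scalar (P : OctonionDivisionAlgebra K O)
    (γ : jordanAut O) (k : K) : K := (P.exists_jordan_smul_one γ k).choose

theorem jordan_smul_one (γ : jordanAut O) (k : K) :
    γ.1 (k • (1 : O)) = P.scalar γ k • (1 : O) := (P.exists_jordan_smul_one γ k).choose_spec

theorem scalar_add (γ : jordanAut O) (k l : K) :
    P.scalar γ (k + l) = P.scalar γ k + P.scalar γ l :=
  P.smul_one_injective (by rw [← P.jordan_smul_one, add_smul, jordanAut.map_add γ, add_smul,
    P.jordan_smul_one, P.jordan_smul_one])

theorem scalar_one (γ : jordanAut O) : P.scalar γ 1 = 1 :=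
  P.smul_one_injective (by rw [← P.jordan_smul_one, one_smul, jordanAut.map_one γ])

theorem scalar_zero (γ : jordanAut O) : P.scalar γ 0 = 0 :=
  P.smul_one_injective (by rw [← P.jordan_smul_one, zero_smul, jordanAut.map_zero γ])

theorem scalar_mul_self (γ : jordanAut O) (k : K) :
    P.scalar γ (k * k) = P.scalar γ k * P.scalar γ k :=
  P.smul_one_injective (by
    rw [← P.jordan_smul_one, SemigroupAction.mul_smul, ← P.smul_one_mul k, jordanAut.map_mul_self γ,
      P.jordan_smul_one, P.smul_one_mul, smul_smul])

theorem scalar_mul (γ : jordanAut O) (k l : K) :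
    P.scalar γ (k * l) = P.scalar γ k * P.scalar γ l := by
  -- In characteristic two polarising squares gives nothing. Instead the triple product shows that
  -- the two sides have equal squares, and squaring is injective there.
  by_cases h2 : (2 : K) = 0
  · have hsq : P.scalar γ (k * l) + P.scalar γ k * P.scalar γ l = 0 := by
      have hj : P.scalar γ (k * (l * l) * k) =
          P.scalar γ k * P.scalar γ (l * l) * P.scalar γ k := by
        apply P.smul_one_injective
        have := jordanAut.map_triple γ (k • (1 : O)) ((l * l) • (1 : O))
        simpa only [P.smul_one_mul, smul_smul, P.mul_smul_one, P.jordan_smul_one,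
          mul_comm, mul_left_comm] using this
      have h1 := P.scalar_mul_self γ (k * l)
      rw [show k * l * (k * l) = k * (l * l) * k by ring, hj, P.scalar_mul_self] at h1
      rw [← pow_eq_zero_iff (two_ne_zero)]
      linear_combination
        (P.scalar γ (k * l) ^ 2 + P.scalar γ (k * l) * P.scalar γ k * P.scalar γ l) * h2 + h1
    linear_combination hsq - P.scalar γ k * P.scalar γ l * h2
  · have h := P.scalar_mul_self γ (k + l)
    rw [show (k + l) * (k + l) = k * k + l * l + (k * l + k * l) by ring] at h
    simp only [P.scalar_add, P.scalar_mul_self] at h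
    apply mul_left_cancel₀ h2
    linear_combination h

theorem scalar_two (γ : jordanAut O) : P.scalar γ 2 = 2 := by
  rw [← one_add_one_eq_two, P.scalar_add, P.scalar_one]

/-- If the trace vanished identically, `conj` would be `-1`; as it fixes `1`, it would be the
identity, and an anti-automorphism equal to the identity forces commutativity. -/
theorem exists_tr_eq_one : ∃ x : O, P.tr x = 1 := by
  obtain ⟨x, hx⟩ : ∃ x, P.tr x ≠ 0 := by
    by_contra! h
    obtain ⟨x, y, hxy⟩ := P.not_commutative
    have h1 : ∀ z : O, P.conj z = z := fun z => by
      rw [P.conj_of_tr (h z), ← neg_one_mul, ← P.conj_of_tr (h 1), P.conj_one, one_mul]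
    exact hxy (by rw [← h1 (x * y), P.conj_mul, h1, h1])
  exact ⟨(P.tr x)⁻¹ • x, by rw [P.tr_smul, inv_mul_cancel₀ hx]⟩

theorem jordan_smul (γ : jordanAut O) (k : K) (x : O) :
    γ.1 (k • x) = P.scalar γ k • γ.1 x := by
  -- For trace one, `x k x = k x² = k x - k N(x)`, so applying `γ` to the triple product isolates `γ
  -- (k x)`. Other elements are reduced to this case by rescaling, or by adding an element of trace
  -- one.
  have h1 : ∀ (k : K) (x : O), P.tr x = 1 → γ.1 (k • x) = P.scalar γ k • γ.1 x := by
    intro k x hx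
    have h := jordanAut.map_triple γ x (k • (1 : O))
    rw [P.jordan_smul_one, P.mul_smul_one, P.mul_smul_one, P.smul_mul, P.smul_mul,
      ← jordanAut.map_mul_self γ, P.mul_self, hx, one_smul, smul_sub, smul_smul,
      jordanAut.map_sub γ, jordanAut.map_sub γ,
      P.jordan_smul_one, P.jordan_smul_one, P.scalar_mul, smul_sub, smul_smul] at h
    simpa using h
  have h2 : ∀ (k : K) (x : O), P.tr x ≠ 0 → γ.1 (k • x) = P.scalar γ k • γ.1 x := by
    intro k x hx
    have hx' : P.tr ((P.tr x)⁻¹ • x) = 1 := by rw [P.tr_smul, inv_mul_cancel₀ hx]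
    have e : x = P.tr x • ((P.tr x)⁻¹ • x) := by rw [smul_smul, mul_inv_cancel₀ hx, one_smul]
    rw [e, smul_smul, h1 _ _ hx', h1 _ _ hx', P.scalar_mul, smul_smul]
  by_cases hx : P.tr x = 0
  · obtain ⟨y, hy⟩ := P.exists_tr_eq_one
    have h := h1 k (x + y) (by rw [P.tr_add, hx, hy, zero_add])
    rw [smul_add, jordanAut.map_add γ, jordanAut.map_add γ, smul_add, h1 k y hy] at h
    exact add_right_cancel h
  · exact h2 k x hx

theorem jordan_tr_nm (γ : jordanAut O) (x : O) :
    P.tr (γ.1 x) = P.scalar γ (P.tr x) ∧ P.nm (γ.1 x) = P.scalar γ (P.nm x) := by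
  by_cases hx : ∃ k : K, x = k • (1 : O)
  · obtain ⟨k, rfl⟩ := hx
    rw [P.jordan_smul_one, P.tr_smul, P.tr_smul, P.nm_smul, P.nm_smul, P.tr_one, P.nm_one,
      pow_two, pow_two]
    simp only [P.scalar_mul, P.scalar_two, P.scalar_one, and_self]
  · have h := jordanAut.map_mul_self γ x
    rw [P.mul_self, P.mul_self, jordanAut.map_sub γ, P.jordan_smul, P.jordan_smul_one] at h
    have h' : (P.scalar γ (P.tr x) - P.tr (γ.1 x)) • γ.1 x =
        (P.scalar γ (P.nm x) - P.nm (γ.1 x)) • (1 : O) := by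
      rw [sub_smul, sub_smul, sub_eq_sub_iff_sub_eq_sub, h]
    -- Two quadratic equations for `γ x` are compared. Their coefficients agree because `γ x` is not
    -- a scalar: otherwise `γ⁻¹` would make `x` one.
    have ht : P.scalar γ (P.tr x) - P.tr (γ.1 x) = 0 := by
      by_contra ht
      apply hx
      have e : γ.1 x = ((P.scalar γ (P.tr x) - P.tr (γ.1 x))⁻¹ *
          (P.scalar γ (P.nm x) - P.nm (γ.1 x))) • (1 : O) := by
        rw [SemigroupAction.mul_smul, ← h', smul_smul, inv_mul_cancel₀ ht, one_smul]
      exact ⟨_, ((γ.1.symm_apply_apply x).symm.trans (congrArg (γ⁻¹).1 e)).trans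
        (P.jordan_smul_one γ⁻¹ _)⟩
    rw [ht, zero_smul, ← zero_smul K (1 : O)] at h'
    exact ⟨(sub_eq_zero.1 ht).symm, (sub_eq_zero.1 (P.smul_one_injective h').symm).symm⟩

theorem jordan_tr (γ : jordanAut O) (x : O) : P.tr (γ.1 x) = P.scalar γ (P.tr x) :=
  (P.jordan_tr_nm γ x).1

theorem jordan_nm (γ : jordanAut O) (x : O) : P.nm (γ.1 x) = P.scalar γ (P.nm x) :=
  (P.jordan_tr_nm γ x).2

theorem jordan_conj (γ : jordanAut O) (x : O) : γ.1 (P.conj x) = P.conj (γ.1 x) := by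
  rw [P.conj_eq, P.conj_eq, jordanAut.map_sub γ, P.jordan_smul_one, P.jordan_tr]

theorem jordan_polar (γ : jordanAut O) (x y : O) :
    P.polar (γ.1 x) (γ.1 y) = P.scalar γ (P.polar x y) := by
  have h := P.nm_add (γ.1 x) (γ.1 y)
  rw [← jordanAut.map_add γ, P.jordan_nm, P.nm_add, P.jordan_nm, P.jordan_nm, P.scalar_add,
    P.scalar_add, add_right_inj] at h
  exact h.symm

/-- The standard involution as a Jordan automorphism. -/
def conjJordan (P : OctonionDivisionAlgebra K O) : jordanAut O :=
  ⟨⟨P.conj, P.conj, P.conj_conj, P.conj_conj⟩, P.conj_add, P.conj_one, fun x y => by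
    simp only [Equiv.coe_fn_mk, P.conj_mul, P.flexible]⟩

theorem conjJordan_apply (x : O) : P.conjJordan.1 x = P.conj x := rfl

theorem conjJordan_mem_center : P.conjJordan ∈ Subgroup.center (jordanAut O) := by
  rw [Subgroup.mem_center_iff]
  intro γ
  ext x
  exact P.jordan_conj γ x

theorem conjJordan_mul_self : P.conjJordan * P.conjJordan = 1 := by
  ext x
  exact P.conj_conj x

end OctonionDivisionAlgebra

/-! ### The group of isotopies. -/

/-- `γ` is a homomorphism onto the isotope with multiplication `(x, y) ↦ (x a⁻¹) (a y)`, where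
`a'` stands for the inverse of `a`. -/
def IsIsotopic {O : Type v} [NonAssocRing O] (γ : O → O) (a a' : O) : Prop :=
  ∀ x y, γ (x * y) = (γ x * a') * (a * γ y)

namespace OctonionDivisionAlgebra

variable {K : Type u} {O : Type v} [Field K] [NonAssocRing O] [Module K O]
  (P : OctonionDivisionAlgebra K O)

theorem mul_mul_inv_mul_inv (P : OctonionDivisionAlgebra K O)
    {a a' b b' : O} (ha : a * a' = 1) (hb : b * b' = 1) :
    (a * b) * (b' * a') = 1 := by
  rw [P.inv_eq ha, P.inv_eq hb, P.smul_mul, P.mul_smul, P.mul_smul, P.mul_smul, ← P.conj_mul,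
    P.mul_conj, P.nm_mul, smul_smul, smul_smul]
  have h1 := P.ne_zero_of_mul_eq_one ha
  have h2 := P.ne_zero_of_mul_eq_one hb
  rw [← one_smul K (1 : O), smul_smul]
  congr 1
  field_simp

theorem jordan_inv (P : OctonionDivisionAlgebra K O)
    (γ : jordanAut O) {a a' : O} (h : a * a' = 1) : γ.1 a * γ.1 a' = 1 := by
  have h1 := jordanAut.map_triple γ a a'
  rw [h, one_mul] at h1
  have h2 : (γ.1 a * γ.1 a' - 1) * γ.1 a = 0 := by rw [sub_mul, ← h1, one_mul, sub_self]
  rcases P.eq_zero_or_eq_zero h2 with h3 | h3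
  · exact sub_eq_zero.1 h3
  · have : a = 0 := γ.1.injective (by rw [h3, jordanAut.map_zero])
    exact absurd (P.nm_eq_zero.2 this) (P.ne_zero_of_mul_eq_one h)

theorem isotope_mul_right (P : OctonionDivisionAlgebra K O) {a a' : O} (h : a * a' = 1) (x y : O) :
    (x * a') * (a * y) * a' = x * (y * a') := by
  rw [P.right_moufang, P.inv_cancel_left h]

theorem isotope_mul_left (P : OctonionDivisionAlgebra K O) {a a' : O} (h : a * a' = 1) (x y : O) :
    a * ((x * a') * (a * y)) = (a * x) * y := by
  rw [P.left_moufang, ← P.flexible, P.inv_cancel_right (P.inv_comm h)]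

/-- The isotope has the same product `x y x` as the original algebra, by the Moufang identities. -/
theorem isIsotopic_triple (P : OctonionDivisionAlgebra K O)
    {γ : O → O} {a a' : O} (h : a * a' = 1) (hγ : IsIsotopic γ a a')
    (x y : O) : γ (x * y * x) = γ x * γ y * γ x := by
  rw [hγ, hγ, P.isotope_mul_right h, P.middle_moufang, P.inv_cancel_right (P.inv_comm h)]

/-- The group of all Jordan automorphisms that are isomorphisms onto an isotope. -/
def isotopyGroup (P : OctonionDivisionAlgebra K O) : Subgroup (jordanAut O) where
  carrier := {γ | ∃ a a', a * a' = 1 ∧ IsIsotopic γ.1 a a'}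
  mul_mem' := by
    rintro γ δ ⟨a, a', ha, hγ⟩ ⟨b, b', hb, hδ⟩
    -- The parameter `b` of the inner map is carried over by `γ` and multiplied by the parameter `a`
    -- of the outer one.
    refine ⟨a * γ.1 b, γ.1 b' * a', P.mul_mul_inv_mul_inv ha (P.jordan_inv γ hb), fun x y => ?_⟩
    change γ.1 (δ.1 (x * y)) = (γ.1 (δ.1 x) * _) * (_ * γ.1 (δ.1 y))
    rw [hδ, hγ, hγ, hγ, P.isotope_mul_right ha, P.isotope_mul_left ha]
  one_mem' := ⟨1, 1, one_mul 1, fun x y => by simp⟩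
  inv_mem' := by
    rintro γ ⟨a, a', ha, hγ⟩
    have key : ∀ x y, (γ⁻¹).1 (x * y) = (γ⁻¹).1 (x * a) * (γ⁻¹).1 (a' * y) := by
      intro x y
      have hi : ∀ z, γ.1 ((γ⁻¹).1 z) = z := γ.1.apply_symm_apply
      apply γ.1.injective
      rw [hγ, hi, hi, hi, P.inv_cancel_right ha, P.inv_cancel_left (P.inv_comm ha)]
    have ha' := P.inv_comm ha
    -- The formula `key` with one argument equal to `1` expresses `γ⁻¹ (x a)` and `γ⁻¹ (a⁻¹ y)` as
    -- products, which reveals the parameter `γ⁻¹ (a⁻¹)`.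
    refine ⟨(γ⁻¹).1 a', (γ⁻¹).1 a, P.jordan_inv _ ha', fun x y => ?_⟩
    have hx := key x 1
    have hy := key 1 y
    rw [mul_one, mul_one] at hx
    rw [one_mul, one_mul] at hy
    have ex : (γ⁻¹).1 (x * a) = (γ⁻¹).1 x * (γ⁻¹).1 a := by
      rw [hx, P.inv_cancel_right (P.jordan_inv _ ha')]
    have ey : (γ⁻¹).1 (a' * y) = (γ⁻¹).1 a' * (γ⁻¹).1 y := by
      rw [hy, P.inv_cancel_left (P.jordan_inv _ ha)]
    rw [key, ex, ey]

/-- If `σ_s` had parameter `a`, then `y x = (x a⁻¹)(a y)`. Taking `x = a` makes `a` central, hence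
scalar, and then `O` would be commutative. -/
theorem conjJordan_notMem : P.conjJordan ∉ P.isotopyGroup := by
  rintro ⟨a, a', ha, h⟩
  have h1 : ∀ x y : O, y * x = (x * a') * (a * y) := fun x y => by
    have := h (P.conj x) (P.conj y)
    simpa only [P.conjJordan_apply, P.conj_mul, P.conj_conj] using this
  have h2 : ∀ y, a * y = y * a := fun y => by rw [h1 a y, ha, one_mul]
  obtain ⟨x, y, hxy⟩ := P.not_commutative
  apply hxy
  obtain ⟨k, rfl⟩ := P.exists_smul_one_of_central h2
  rw [P.smul_one_mul] at ha
  rw [h1 y x, P.smul_one_mul, P.mul_smul, ← P.smul_mul, ← P.mul_smul, ha, mul_one]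

/-- The subgroup generated by the standard involution and the isotopies. -/
def generated (P : OctonionDivisionAlgebra K O) : Subgroup (jordanAut O) :=
  Subgroup.closure ({P.conjJordan} ∪ (P.isotopyGroup : Set (jordanAut O)))

theorem conjJordan_mem_generated : P.conjJordan ∈ P.generated :=
  Subgroup.subset_closure (Or.inl rfl)

theorem isotopyGroup_le_generated : P.isotopyGroup ≤ P.generated :=
  fun _ h => Subgroup.subset_closure (Or.inr h)

/-! ### Reflections generated by isotopies and the standard involution. -/

/-- The reflection in a vector of trace zero. -/
theorem exists_reflection {v : O} (hv : v ≠ 0) (ht : P.tr v = 0) :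
    ∃ δ ∈ P.generated, ∀ x, δ.1 x = x - ((P.nm v)⁻¹ * P.polar x v) • v := by
  obtain ⟨w, hw⟩ := P.exists_inv hv
  have hw' := P.inv_comm hw
  have hn : P.nm v ≠ 0 := P.ne_zero_of_mul_eq_one hw
  have hwv : w = -(P.nm v)⁻¹ • v := by
    rw [P.inv_eq hw, P.conj_of_tr ht, smul_neg, neg_smul]
  have hflex : ∀ y, v * y * w = v * (y * w) := fun y => by
    rw [hwv, P.mul_smul, P.mul_smul, P.mul_smul, P.flexible]
  have hflex' : ∀ y, w * y * v = w * (y * v) := fun y => by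
    rw [hwv, P.smul_mul, P.smul_mul, P.smul_mul, P.flexible]
  -- As `v` has trace zero, `w = v⁻¹` is a scalar multiple of `v`. Cancelling the parameters leaves
  -- `(v x)(y w)`, which the middle Moufang identity turns into `v (x y) w`.
  have hiso : IsIsotopic (fun x => v * x * w) w v := fun x y => by
    simp only
    rw [P.inv_cancel_right hw', hflex y, P.inv_cancel_left hw, hwv, P.mul_smul, P.mul_smul,
      P.mul_smul, P.middle_moufang]
  have hinv : ∀ x, v * (w * x * v) * w = x := fun x => by
    rw [hflex', P.inv_cancel_left hw', P.inv_cancel_right hw]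
  have hinv' : ∀ x, w * (v * x * w) * v = x := fun x => by
    rw [hflex, P.inv_cancel_left hw, P.inv_cancel_right hw']
  let c : jordanAut O := ⟨⟨fun x => v * x * w, fun x => w * x * v, hinv', hinv⟩,
    fun x y => by simp [mul_add, add_mul], by simpa using hw,
    P.isIsotopic_triple hw' hiso⟩
  have hc : c ∈ P.isotopyGroup := ⟨w, v, hw', hiso⟩
  refine ⟨P.conjJordan * c, mul_mem P.conjJordan_mem_generated (P.isotopyGroup_le_generated hc),
    fun x => ?_⟩
  change P.conj (v * x * w) = _
  have hb : P.conj x * v = P.polar x v • (1 : O) + v * x := by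
    have := P.conj_mul_add x v 1
    rw [mul_one, mul_one, P.conj_of_tr ht] at this
    rw [← this]
    simp
  rw [hwv, P.mul_smul, P.conj_smul, P.conj_mul, P.conj_mul, P.conj_of_tr ht, neg_mul, mul_neg,
    mul_neg, neg_neg, hb, mul_add, P.mul_smul_one, P.left_alternative, P.mul_self, ht, zero_smul,
    zero_sub, neg_mul, P.smul_one_mul, smul_add, smul_neg, smul_smul, smul_smul, neg_mul, neg_mul,
    inv_mul_cancel₀ hn]
  simp only [neg_smul, one_smul]
  abel

/-- If `γ x` and `z` have equal norm and trace, `γ x - z` has trace zero and the reflection in it,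
when it is non-zero, takes `γ x` to `z`. The reflection fixes every vector orthogonal to the
difference, so corrections already made can be kept. -/
theorem exists_generated_apply_eq (γ : jordanAut O) {x z : O} (hn : P.nm z = P.nm (γ.1 x))
    (ht : P.tr z = P.tr (γ.1 x)) :
    ∃ δ ∈ P.generated, (δ * γ).1 x = z ∧
      ∀ y, P.polar z (γ.1 y) = P.polar (γ.1 x) (γ.1 y) → (δ * γ).1 y = γ.1 y := by
  by_cases hv : γ.1 x - z = 0
  · exact ⟨1, one_mem _, by rw [one_mul]; exact sub_eq_zero.1 hv, fun y _ => by rw [one_mul]⟩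
  · obtain ⟨δ, hδ, h⟩ := P.exists_reflection hv (by rw [P.tr_sub, ht, sub_self])
    refine ⟨δ, hδ, ?_, fun y hy => ?_⟩
    · have hp : P.polar (γ.1 x) (γ.1 x - z) = P.nm (γ.1 x - z) := by
        rw [sub_eq_add_neg, P.nm_add, ← neg_one_smul K z, P.polar_add_right, P.polar_smul_right,
          P.nm_smul, P.polar_self, hn]
        ring
      change δ.1 (γ.1 x) = z
      rw [h, hp, inv_mul_cancel₀ (fun h0 => hv (P.nm_eq_zero.1 h0)), one_smul]
      abel
    · change δ.1 (γ.1 y) = γ.1 y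
      rw [h, P.polar_comm, P.polar_sub_left, hy, sub_self, mul_zero, zero_smul, sub_zero]

/-! ### Correcting a Jordan automorphism to a ring automorphism. -/

theorem polar_symm_mk (h g : P.H.Alg) :
    P.polar (P.equiv.symm (Doubling.mk 0 h)) (P.equiv.symm (Doubling.mk g 0)) = 0 := by
  apply P.smul_one_injective
  rw [← P.bilin_eq, zero_smul]
  apply P.equiv.injective
  rw [bilin, map_add, P.map_mul, P.map_mul, P.equiv_conj, P.equiv_conj,
    P.equiv.apply_symm_apply, P.equiv.apply_symm_apply, map_zero]
  refine Doubling.ext ?_ ?_ <;> simp [Involution.map_zero]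

theorem exists_frame : ∃ (H : Submodule K O) (u j e : O), H = Submodule.span K {1, u, j, j * u} ∧
    (∀ x ∈ H, ∀ y ∈ H, x * y ∈ H) ∧ (∀ x ∈ H, P.polar e x = 0) ∧
    ∀ z, ∃ x ∈ H, ∃ y ∈ H, z = x + e * y := by
  obtain ⟨t, ht⟩ := P.H.σ_nontrivial
  have ht' : ∀ k : K, t ≠ k • 1 := by
    rintro k rfl
    exact ht (by rw [Involution.map_smul, Involution.map_one])
  let ι : P.H.Alg → O := fun h => P.equiv.symm (Doubling.mk h 0)
  have ι_mul : ∀ x y, ι (x * y) = ι x * ι y := fun x y => by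
    apply P.equiv.injective
    simp only [ι, P.map_mul, P.equiv.apply_symm_apply]
    exact Doubling.ext (by simp [Involution.map_zero]) (by simp)
  let T : P.H.Alg := Doubling.mk t 0
  let J : P.H.Alg := Doubling.mk 0 1
  have hJT : ι J * ι T = P.equiv.symm (Doubling.mk (Doubling.mk 0 t) 0) := by
    rw [← ι_mul]
    simp only [ι]
    congr 2
    exact Doubling.ext (by simp [J, T]) (by simp [J, T])
  have mem : ∀ x, x ∈ Submodule.span K {1, ι T, ι J, ι J * ι T} ↔ ∃ h, x = ι h := by
    intro x
    simp only [Submodule.mem_span_insert, Submodule.mem_span_singleton]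
    constructor
    · rintro ⟨a, _, ⟨b, _, ⟨c, _, ⟨d, rfl⟩, rfl⟩, rfl⟩, rfl⟩
      refine ⟨Doubling.mk (a • 1 + b • t) (c • 1 + d • t), P.equiv.injective ?_⟩
      rw [hJT]
      simp only [ι, map_add, map_smul, P.equiv.apply_symm_apply, P.map_one]
      exact Doubling.ext (Doubling.ext (by simp [T, J]) (by simp [T, J])) (by simp)
    · rintro ⟨h, rfl⟩
      obtain ⟨a, b, hab⟩ := P.H.exists_linear ht' h.fst
      obtain ⟨c, d, hcd⟩ := P.H.exists_linear ht' h.snd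
      refine ⟨a, _, ⟨b, _, ⟨c, _, ⟨d, rfl⟩, rfl⟩, rfl⟩, P.equiv.injective ?_⟩
      rw [hJT]
      simp only [ι, map_add, map_smul, P.equiv.apply_symm_apply, P.map_one]
      exact Doubling.ext (Doubling.ext (by simp [T, J, hab]) (by simp [T, J, hcd])) (by simp)
  refine ⟨_, ι T, ι J, P.equiv.symm (Doubling.mk 0 1), rfl, ?_, ?_, ?_⟩
  · intro x hx y hy
    rw [mem] at *
    obtain ⟨g, rfl⟩ := hx
    obtain ⟨h, rfl⟩ := hy
    exact ⟨g * h, (ι_mul g h).symm⟩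
  · intro x hx
    obtain ⟨g, rfl⟩ := (mem x).1 hx
    exact P.polar_symm_mk 1 g
  · intro z
    refine ⟨ι (P.equiv z).fst, (mem _).2 ⟨_, rfl⟩, ι (P.equiv z).snd, (mem _).2 ⟨_, rfl⟩,
      P.equiv.injective ?_⟩
    simp only [ι, map_add, P.map_mul, P.equiv.apply_symm_apply]
    exact Doubling.ext (by simp) (by simp)

/-- One product suffices: `j (j u) = j² u` reduces to `j u` and `u` by the quadratic equation of
`j`, `u (j u)` is a triple product, and reversed products follow since `x y + y x` is preserved. -/
theorem jordan_mul_of_mem_span (P : OctonionDivisionAlgebra K O) (γ : jordanAut O) {u j : O}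
    (h : γ.1 (j * u) = γ.1 j * γ.1 u) {x y : O}
    (hx : x ∈ Submodule.span K {1, u, j, j * u}) (hy : y ∈ Submodule.span K {1, u, j, j * u}) :
    γ.1 (x * y) = γ.1 x * γ.1 y := by
  have hj : γ.1 (j * (j * u)) = γ.1 j * γ.1 (j * u) := by
    rw [P.left_alternative, h, P.left_alternative, ← jordanAut.map_mul_self, P.mul_self, sub_mul,
      P.smul_mul, P.smul_one_mul, jordanAut.map_sub, jordanAut.map_sub, P.jordan_smul,
      P.jordan_smul, P.jordan_smul, P.jordan_smul_one, sub_mul, P.smul_mul, P.smul_one_mul, h]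
  have hu : γ.1 (u * (j * u)) = γ.1 u * γ.1 (j * u) := by
    rw [P.flexible, jordanAut.map_triple, h, P.flexible]
  induction hx, hy using Submodule.span_induction₂ with
  | mem_mem x y hx hy =>
    simp only [Set.mem_insert_iff, Set.mem_singleton_iff] at hx hy
    rcases hx with rfl | rfl | rfl | rfl <;> rcases hy with rfl | rfl | rfl | rfl <;>
    first
    | simp only [one_mul, mul_one, jordanAut.map_one]
    | exact jordanAut.map_mul_self _ _
    | assumption
    | (apply jordanAut.map_mul_swap; assumption)
  | zero_left y hy => simp [jordanAut.map_zero]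
  | zero_right x hx => simp [jordanAut.map_zero]
  | add_left x y z _ _ _ h₁ h₂ => simp only [add_mul, jordanAut.map_add, h₁, h₂]
  | add_right x y z _ _ _ h₁ h₂ => simp only [mul_add, jordanAut.map_add, h₁, h₂]
  | smul_left r x y _ _ h => simp only [P.smul_mul, P.jordan_smul, h]
  | smul_right r x y _ _ h => simp only [P.mul_smul, P.jordan_smul, h]

section Extend

variable {H : Submodule K O}

theorem conj_mem (one_mem : (1 : O) ∈ H) {x : O} (hx : x ∈ H) : P.conj x ∈ H := by
  rw [P.conj_eq]
  exact H.sub_mem (H.smul_mem _ one_mem) hx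

/-- The target `γ e · γ x` has the norm and trace of `γ (e x)`. Its polar products with `γ H`, and
with each `γ (e y)` that already splits, also agree with those of `γ (e x)`, so the reflection
disturbs none of them. -/
theorem exists_generated_extend (one_mem : (1 : O) ∈ H) (γ : jordanAut O)
    (hγ : ∀ x ∈ H, ∀ y ∈ H, γ.1 (x * y) = γ.1 x * γ.1 y) (e : O) {x : O} (hx : x ∈ H) :
    ∃ δ ∈ P.generated, (∀ y ∈ H, (δ * γ).1 y = γ.1 y) ∧
      (δ * γ).1 (e * x) = γ.1 e * γ.1 x ∧
      ∀ y, γ.1 (e * y) = γ.1 e * γ.1 y → (δ * γ).1 (e * y) = γ.1 (e * y) := by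
  have hp : ∀ y ∈ H, P.polar (γ.1 e * γ.1 x) (γ.1 y) = P.polar (γ.1 (e * x)) (γ.1 y) := by
    intro y hy
    rw [P.polar_mul_left, ← P.jordan_conj, ← hγ y hy _ (P.conj_mem one_mem hx), P.jordan_polar,
      P.jordan_polar, P.polar_mul_left]
  obtain ⟨δ, hδ, h₁, h₂⟩ := P.exists_generated_apply_eq γ (x := e * x) (z := γ.1 e * γ.1 x)
    (by rw [P.nm_mul, P.jordan_nm, P.jordan_nm, P.jordan_nm, P.nm_mul, P.scalar_mul])
    (by simpa only [jordanAut.map_one, P.polar_one_right] using hp 1 one_mem)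
  refine ⟨δ, hδ, fun y hy => h₂ y (hp y hy), h₁, fun y hy => h₂ _ ?_⟩
  rw [P.jordan_polar, hy, P.polar_mul_mul_left, P.polar_mul_mul_left, P.scalar_mul, P.jordan_polar,
    P.jordan_nm]

/-- With `e ⊥ H`, the product on `H + e H` is determined by the product of `H`, conjugation and
`N(e)`. The same formulas hold for `γ e` and `γ H`, as `γ` preserves orthogonality. -/
theorem jordan_mul_of_frame (one_mem : (1 : O) ∈ H) (γ : jordanAut O)
    (mul_mem : ∀ x ∈ H, ∀ y ∈ H, x * y ∈ H)
    (hγ : ∀ x ∈ H, ∀ y ∈ H, γ.1 (x * y) = γ.1 x * γ.1 y) {e : O}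
    (he : ∀ x ∈ H, P.polar e x = 0) (hγe : ∀ x ∈ H, γ.1 (e * x) = γ.1 e * γ.1 x)
    (hH : ∀ z, ∃ x ∈ H, ∃ y ∈ H, z = x + e * y) (z t : O) :
    γ.1 (z * t) = γ.1 z * γ.1 t := by
  obtain ⟨x, hx, y, hy, rfl⟩ := hH z
  obtain ⟨p, hp, q, hq, rfl⟩ := hH t
  have ht : P.tr e = 0 := by rw [← P.polar_one_right, he 1 one_mem]
  have ht' : P.tr (γ.1 e) = 0 := by rw [P.jordan_tr, ht, P.scalar_zero]
  have he' : ∀ x ∈ H, P.polar (γ.1 e) (γ.1 x) = 0 := fun x hx => by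
    rw [P.jordan_polar, he x hx, P.scalar_zero]
  have hx' := P.conj_mem one_mem hx
  have hy' := P.conj_mem one_mem hy
  have hq' := P.conj_mem one_mem hq
  have h₁ : γ.1 (x * (e * q)) = γ.1 x * (γ.1 e * γ.1 q) := by
    rw [P.mul_orth ht (he x hx), P.mul_orth ht' (he' x hx), ← P.jordan_conj,
      hγe _ (mul_mem _ hx' _ hq), hγ _ hx' _ hq]
  have h₂ : γ.1 (e * y * p) = γ.1 e * γ.1 y * γ.1 p := by
    rw [P.orth_mul ht (he y hy) (he p hp) (he _ (mul_mem _ hp _ hy)),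
      P.orth_mul ht' (he' y hy) (he' p hp)
        (by rw [← hγ _ hp _ hy]; exact he' _ (mul_mem _ hp _ hy)),
      hγe _ (mul_mem _ hp _ hy), hγ _ hp _ hy]
  have h₃ : γ.1 (e * y * (e * q)) = (γ.1 e * γ.1 y) * (γ.1 e * γ.1 q) := by
    rw [P.orth_mul_orth ht (he q hq) (he _ (mul_mem _ hy _ hq')),
      P.orth_mul_orth ht' (he' q hq)
        (by rw [← P.jordan_conj, ← hγ _ hy _ hq']; exact he' _ (mul_mem _ hy _ hq')),
      ← P.jordan_conj, ← hγ _ hq _ hy', neg_smul, jordanAut.map_neg, P.jordan_smul, P.jordan_nm,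
      neg_smul]
  rw [add_mul, mul_add, mul_add]
  simp only [jordanAut.map_add]
  rw [h₁, h₂, h₃, hγ x hx p hp, hγe y hy, hγe q hq, add_mul, mul_add, mul_add]

end Extend

theorem generated_eq_top : P.generated = ⊤ := by
  rw [eq_top_iff]
  intro γ _
  obtain ⟨H, u, j, e, hH, mul_mem, he, hdec⟩ := P.exists_frame
  have h1 : (1 : O) ∈ H := hH ▸ Submodule.subset_span (by simp)
  have hu : u ∈ H := hH ▸ Submodule.subset_span (by simp)
  have hj : j ∈ H := hH ▸ Submodule.subset_span (by simp)
  have hju : j * u ∈ H := hH ▸ Submodule.subset_span (by simp)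
  obtain ⟨δ₁, hδ₁, h₁, h₁'⟩ := P.exists_generated_apply_eq γ (x := j * u) (z := γ.1 j * γ.1 u)
    (by rw [P.nm_mul, P.jordan_nm, P.jordan_nm, P.jordan_nm, P.nm_mul, P.scalar_mul])
    (by rw [← P.polar_one_right, ← P.polar_one_right, ← jordanAut.map_one γ, P.polar_mul_left,
      jordanAut.map_one γ, one_mul, ← P.jordan_conj, P.jordan_polar, ← jordanAut.map_one γ,
      P.jordan_polar, P.polar_mul_left, one_mul])
  have hju₁ : (δ₁ * γ).1 (j * u) = (δ₁ * γ).1 j * (δ₁ * γ).1 u := by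
    -- Both polar products with `γ j` equal `N(γ j)` times the trace of `γ u`, so the reflection
    -- fixes `γ j`. The argument for `γ u` is the mirror image.
    have e1 : (δ₁ * γ).1 j = γ.1 j := h₁' j (by
      have := P.polar_mul_mul_left (γ.1 j) (γ.1 u) 1
      rw [mul_one] at this
      have h' := P.polar_mul_mul_left j u 1
      rw [mul_one] at h'
      rw [this, P.jordan_polar, h', P.scalar_mul, P.jordan_nm, P.polar_one_right,
        P.polar_one_right, P.jordan_tr])
    have e2 : (δ₁ * γ).1 u = γ.1 u := h₁' u (by
      have := P.polar_mul_mul_right (γ.1 j) 1 (γ.1 u)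
      rw [one_mul] at this
      have h' := P.polar_mul_mul_right j 1 u
      rw [one_mul] at h'
      rw [this, P.jordan_polar, h', P.scalar_mul, P.jordan_nm, P.polar_one_right,
        P.polar_one_right, P.jordan_tr])
    rw [h₁, e1, e2]
  -- the successive modifications of `γ` agree on `H`, and each is multiplicative on one more
  -- product with `e`
  have key : ∀ (γ : jordanAut O) (S : Set O),
      (∀ x ∈ H, ∀ y ∈ H, γ.1 (x * y) = γ.1 x * γ.1 y) →
      (∀ y ∈ S, y ∈ H ∧ γ.1 (e * y) = γ.1 e * γ.1 y) → ∀ x ∈ H,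
      ∃ δ ∈ P.generated, (∀ x ∈ H, ∀ y ∈ H, (δ * γ).1 (x * y) = (δ * γ).1 x * (δ * γ).1 y) ∧
        ∀ y ∈ insert x S, y ∈ H ∧ (δ * γ).1 (e * y) = (δ * γ).1 e * (δ * γ).1 y := by
    intro γ S hγ hS x hx
    obtain ⟨δ, hδ, k₁, k₂, k₃⟩ := P.exists_generated_extend h1 γ hγ e hx
    have ke : (δ * γ).1 e = γ.1 e := by
      simpa using k₃ 1 (by rw [mul_one, jordanAut.map_one, mul_one])
    refine ⟨δ, hδ, fun x hx y hy => ?_, fun y hy => ?_⟩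
    · rw [k₁ _ (mul_mem x hx y hy), k₁ x hx, k₁ y hy, hγ x hx y hy]
    · rcases hy with rfl | hy
      · exact ⟨hx, by rw [k₂, ke, k₁ y hx]⟩
      · exact ⟨(hS y hy).1, by rw [k₃ y (hS y hy).2, ke, k₁ y (hS y hy).1, (hS y hy).2]⟩
  obtain ⟨δ₂, hδ₂, m₂, s₂⟩ := key (δ₁ * γ) {1}
    (fun x hx y hy => P.jordan_mul_of_mem_span _ hju₁ (hH ▸ hx) (hH ▸ hy))
    (by simp [h1, jordanAut.map_one]) u hu
  obtain ⟨δ₃, hδ₃, m₃, s₃⟩ := key _ _ m₂ s₂ j hj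
  obtain ⟨δ₄, hδ₄, m₄, s₄⟩ := key _ _ m₃ s₃ (j * u) hju
  set g := δ₄ * (δ₃ * (δ₂ * (δ₁ * γ))) with hg
  have hge : ∀ x ∈ H, g.1 (e * x) = g.1 e * g.1 x := by
    intro x hx
    rw [hH] at hx
    induction hx using Submodule.span_induction with
    | mem x hx =>
      refine (s₄ x ?_).2
      simp only [Set.mem_insert_iff, Set.mem_singleton_iff] at hx ⊢
      tauto
    | zero => simp [jordanAut.map_zero]
    | add x y _ _ hx hy => simp only [mul_add, jordanAut.map_add, hx, hy]
    | smul k x _ hx => simp only [P.mul_smul, P.jordan_smul, hx]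
  have hmul := P.jordan_mul_of_frame h1 g mul_mem m₄ he hge hdec
  -- A multiplicative map is an isotopy with parameter `1`.
  have hgG : g ∈ P.generated := P.isotopyGroup_le_generated
    ⟨1, 1, one_mul 1, fun x y => by rw [hmul, mul_one, one_mul]⟩
  rw [hg] at hgG
  exact (Subgroup.mul_mem_cancel_left _ hδ₁).1 <| (Subgroup.mul_mem_cancel_left _ hδ₂).1 <|
    (Subgroup.mul_mem_cancel_left _ hδ₃).1 <| (Subgroup.mul_mem_cancel_left _ hδ₄).1 hgG

end OctonionDivisionAlgebra

/-! ### Quaternion subalgebras and the maps `ψ_(H, e, w)`. -/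

theorem IsQuaternionDivisionAlgebra.finrank_eq {K : Type u} {A : Type v} [Field K]
    [NonUnitalNonAssocRing A] [Module K A] (h : IsQuaternionDivisionAlgebra K A) :
    Module.finrank K A = 4 := by
  obtain ⟨D, f, -⟩ := h
  rw [f.finrank_eq, D.finrank_alg]

theorem IsQuaternionDivisionAlgebra.mul_assoc {K : Type u} {A : Type v} [Field K]
    [NonUnitalNonAssocRing A] [Module K A] (h : IsQuaternionDivisionAlgebra K A) (x y z : A) :
    x * y * z = x * (y * z) := by
  obtain ⟨D, f, hf⟩ := h
  exact f.injective (by simp only [hf, D.mul_assoc])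

theorem IsQuaternionDivisionAlgebra.not_commutative {K : Type u} {A : Type v} [Field K]
    [NonUnitalNonAssocRing A] [Module K A] (h : IsQuaternionDivisionAlgebra K A) :
    ∃ x y : A, x * y ≠ y * x := by
  obtain ⟨D, f, hf⟩ := h
  obtain ⟨x, y, hxy⟩ := D.not_commutative
  refine ⟨f.symm x, f.symm y, fun h' => hxy ?_⟩
  simpa only [hf, f.apply_symm_apply] using congrArg f h'

namespace OctonionDivisionAlgebra

variable {K : Type u} {O : Type v} [Field K] [NonAssocRing O] [Module K O]
  (P : OctonionDivisionAlgebra K O)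

/-- The map `(x, y) ↦ x + e y`. -/
def sumMap (P : OctonionDivisionAlgebra K O)
    (H : NonUnitalSubalgebra K O) (e : O) : (H × H) →ₗ[K] O where
  toFun p := p.1 + e * p.2
  map_add' p q := by simp [mul_add]; abel
  map_smul' k p := by simp [P.mul_smul]

section Subalgebra

variable {H : NonUnitalSubalgebra K O}

theorem conj_mem_subalgebra (one_mem : (1 : O) ∈ H) {x : O} (hx : x ∈ H) : P.conj x ∈ H :=
  P.conj_mem (H := H.toSubmodule) one_mem hx

theorem inv_mem_subalgebra (P : OctonionDivisionAlgebra K O)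
    (one_mem : (1 : O) ∈ H) {x y : O} (hx : x ∈ H) (h : x * y = 1) : y ∈ H := by
  rw [P.inv_eq h]
  exact H.smul_mem _ (P.conj_mem_subalgebra one_mem hx)

/-- Valid in every characteristic: if `e ∈ H`, then every `t ∈ H` is `e (e⁻¹ t)`, so orthogonality
makes the trace vanish on `H`. Conjugation is then trivial on `H`, which contradicts
non-commutativity. -/
theorem notMem_of_orthogonal (one_mem : (1 : O) ∈ H) (hH : IsQuaternionDivisionAlgebra K H)
    {e : O} (e_ne : e ≠ 0) (he : ∀ x ∈ H, P.polar e x = 0) :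
    e ∉ H := by
  intro hmem
  obtain ⟨e', hee'⟩ := P.exists_inv e_ne
  have htr : ∀ t ∈ H, P.tr t = 0 := by
    intro t ht
    have h := he _ (P.conj_mem_subalgebra one_mem
      (H.mul_mem (P.inv_mem_subalgebra one_mem hmem hee') ht))
    rwa [polar, P.conj_conj, P.inv_cancel_left (P.inv_comm hee')] at h
  have hconj : ∀ t ∈ H, P.conj t = t := fun t ht => by
    rw [P.conj_of_tr (htr t ht), ← neg_one_mul, ← P.conj_of_tr (htr 1 one_mem), P.conj_one,
      one_mul]
  obtain ⟨x, y, hxy⟩ := hH.not_commutative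
  apply hxy
  apply Subtype.ext
  change (x : O) * y = y * x
  rw [← hconj _ (H.mul_mem x.2 y.2), P.conj_mul, hconj _ x.2, hconj _ y.2]

theorem eq_zero_of_add_mul_eq_zero (one_mem : (1 : O) ∈ H) (hH : IsQuaternionDivisionAlgebra K H)
    {e : O} (e_ne : e ≠ 0) (he : ∀ x ∈ H, P.polar e x = 0)
    {x y : O} (hx : x ∈ H) (hy : y ∈ H) (h : x + e * y = 0) :
    x = 0 ∧ y = 0 := by
  have hy0 : y = 0 := by
    by_contra hne
    obtain ⟨y', hyy'⟩ := P.exists_inv hne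
    apply P.notMem_of_orthogonal one_mem hH e_ne he
    have : e = -x * y' := by
      rw [← eq_neg_of_add_eq_zero_right h, P.inv_cancel_right hyy']
    rw [this]
    exact H.mul_mem (H.neg_mem hx) (P.inv_mem_subalgebra one_mem hy hyy')
  refine ⟨?_, hy0⟩
  rwa [hy0, mul_zero, add_zero] at h

/-- Injectivity is enough, since `4 + 4 = 8`. -/
theorem sumMap_bijective (one_mem : (1 : O) ∈ H) (hH : IsQuaternionDivisionAlgebra K H)
    {e : O} (e_ne : e ≠ 0) (he : ∀ x ∈ H, P.polar e x = 0) :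
    Function.Bijective (P.sumMap H e) := by
  have hinj : Function.Injective (P.sumMap H e) := by
    rw [injective_iff_map_eq_zero]
    rintro ⟨x, y⟩ h
    obtain ⟨h1, h2⟩ := P.eq_zero_of_add_mul_eq_zero one_mem hH e_ne he x.2 y.2 h
    exact Prod.ext (Subtype.ext h1) (Subtype.ext h2)
  have := P.finite
  have := Module.finite_of_finrank_eq_succ hH.finrank_eq
  refine ⟨hinj, (LinearMap.injective_iff_surjective_of_finrank_eq_finrank ?_).1 hinj⟩
  rw [Module.finrank_prod, hH.finrank_eq, P.finrank_eq]

theorem exists_add_mul (one_mem : (1 : O) ∈ H) (hH : IsQuaternionDivisionAlgebra K H)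
    {e : O} (e_ne : e ≠ 0) (he : ∀ x ∈ H, P.polar e x = 0)
    (z : O) : ∃ x ∈ H, ∃ y ∈ H, z = x + e * y := by
  obtain ⟨⟨x, y⟩, h⟩ := (P.sumMap_bijective one_mem hH e_ne he).2 z
  exact ⟨x, x.2, y, y.2, h.symm⟩

theorem exists_isPsi (one_mem : (1 : O) ∈ H) (hH : IsQuaternionDivisionAlgebra K H)
    {e : O} (e_ne : e ≠ 0) (he : ∀ x ∈ H, P.polar e x = 0)
    {w : O} (hw : w ∈ H) (w_ne : w ≠ 0) : ∃ ψ, P.IsPsi H e w ψ := by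
  obtain ⟨w', hww'⟩ := P.exists_inv w_ne
  have hb := P.sumMap_bijective one_mem hH e_ne he
  let Φ := LinearEquiv.ofBijective (P.sumMap H e) hb
  refine ⟨fun z => (Φ.symm z).1 + e * ((w' * (Φ.symm z).2) * w), one_mem, hH, e_ne, fun x hx => ?_,
    hw, w_ne, w', P.inv_mem_subalgebra one_mem hw hww', hww', P.inv_comm hww', ?_⟩
  · rw [P.bilin_eq, he x hx, zero_smul]
  · intro x hx y hy
    have : Φ.symm (x + e * y) = (⟨x, hx⟩, ⟨y, hy⟩) := by
      rw [LinearEquiv.symm_apply_eq]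
      rfl
    simp only [this]

end Subalgebra

theorem exists_isotopic_of_isPsi {H : NonUnitalSubalgebra K O}
    {e w w' : O} {ψ : O → O} (h : P.IsPsi H e w ψ) (hw : w * w' = 1) :
    ∃ γ : jordanAut O, ⇑γ.1 = ψ ∧ IsIsotopic ψ w' w := by
  obtain ⟨one_mem, hH, e_ne, horth, w_mem, w_ne, w₁, hw₁, hww₁, hw₁w, hψ⟩ := h
  obtain rfl : w' = w₁ := by rw [P.inv_eq hw, P.inv_eq hww₁]
  have he : ∀ x ∈ H, P.polar e x = 0 := fun x hx =>
    P.smul_one_injective (by rw [← P.bilin_eq, horth x hx, zero_smul])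
  have ht : P.tr e = 0 := by rw [← P.polar_one_right, he 1 one_mem]
  have dec := P.exists_add_mul one_mem hH e_ne he
  have cm : ∀ {x}, x ∈ H → P.conj x ∈ H := fun hx => P.conj_mem_subalgebra one_mem hx
  have assoc : ∀ {x y z}, x ∈ H → y ∈ H → z ∈ H → x * y * z = x * (y * z) :=
    fun hx hy hz => congrArg Subtype.val (hH.mul_assoc ⟨_, hx⟩ ⟨_, hy⟩ ⟨_, hz⟩)
  -- This is the product of the double `(H, -N(e))`.
  have mul : ∀ {x y p q}, x ∈ H → y ∈ H → p ∈ H → q ∈ H → (x + e * y) * (p + e * q) =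
      (x * p + -P.nm e • (q * P.conj y)) + e * (P.conj x * q + p * y) := by
    intro x y p q hx hy hp hq
    rw [add_mul, mul_add, mul_add, P.mul_orth ht (he x hx),
      P.orth_mul ht (he y hy) (he p hp) (he _ (H.mul_mem hp hy)),
      P.orth_mul_orth ht (he q hq) (he _ (H.mul_mem hy (cm hq))), mul_add]
    abel
  have hadd : ∀ z t, ψ (z + t) = ψ z + ψ t := by
    intro z t
    obtain ⟨x, hx, y, hy, rfl⟩ := dec z
    obtain ⟨p, hp, q, hq, rfl⟩ := dec t
    rw [show x + e * y + (p + e * q) = (x + p) + e * (y + q) by rw [mul_add]; abel,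
      hψ _ (H.add_mem hx hp) _ (H.add_mem hy hq), hψ x hx y hy, hψ p hp q hq]
    simp only [mul_add, add_mul]
    abel
  have hiso : IsIsotopic ψ w' w := by
    intro z t
    obtain ⟨x, hx, y, hy, rfl⟩ := dec z
    obtain ⟨p, hp, q, hq, rfl⟩ := dec t
    have hn := P.ne_zero_of_mul_eq_one hw
    have hcw : P.conj w' = (P.nm w)⁻¹ • w := by
      rw [P.inv_eq hw, P.conj_smul, P.conj_conj]
    -- With `w' = w⁻¹`, the outer factors `w` and `w⁻¹` of the isotope are absorbed using `(e m) w =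
    -- e (w m)` and `w⁻¹ (e m) = e (N(w)⁻¹ w m)`. In the product of the results the `w`'s then
    -- cancel by associativity of `H`.
    have e₁ : (x + e * (w' * y * w)) * w = x * w + e * (y * w) := by
      have hm := H.mul_mem (H.mul_mem hw₁ hy) w_mem
      rw [add_mul, P.orth_mul ht (he _ hm) (he _ w_mem) (he _ (H.mul_mem w_mem hm)),
        assoc hw₁ hy w_mem, P.inv_cancel_left hw₁w]
    have e₂ : w' * (p + e * (w' * q * w)) = w' * p + e * ((P.nm w)⁻¹ • (q * w)) := by
      rw [mul_add, P.mul_orth ht (he _ hw₁), hcw, P.smul_mul, assoc hw₁ hq w_mem,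
        P.inv_cancel_left hw₁w]
    have t₁ : (x * w) * (w' * p) = x * p := by
      rw [assoc hx w_mem (H.mul_mem hw₁ hp), P.inv_cancel_left hw₁w]
    have t₂ : ((P.nm w)⁻¹ • (q * w)) * P.conj (y * w) = q * P.conj y := by
      rw [P.smul_mul, P.conj_mul, assoc hq w_mem (H.mul_mem (cm w_mem) (cm hy)),
        P.mul_conj_cancel_left, P.mul_smul, smul_smul, inv_mul_cancel₀ hn, one_smul]
    have t₃ : P.conj (x * w) * ((P.nm w)⁻¹ • (q * w)) = w' * (P.conj x * q) * w := by
      rw [P.mul_smul, P.conj_mul, ← P.smul_mul, ← P.smul_mul, ← P.inv_eq hw,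
        assoc hw₁ (H.mul_mem (cm hx) hq) w_mem, assoc (cm hx) hq w_mem,
        assoc hw₁ (cm hx) (H.mul_mem hq w_mem)]
    have t₄ : (w' * p) * (y * w) = w' * (p * y) * w := by
      rw [assoc hw₁ (H.mul_mem hp hy) w_mem, assoc hp hy w_mem,
        assoc hw₁ hp (H.mul_mem hy w_mem)]
    rw [mul hx hy hp hq, hψ _ (H.add_mem (H.mul_mem hx hp) (H.smul_mem _ (H.mul_mem hq (cm hy))))
      _ (H.add_mem (H.mul_mem (cm hx) hq) (H.mul_mem hp hy)), hψ x hx y hy, hψ p hp q hq, e₁, e₂,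
      mul (H.mul_mem hx w_mem) (H.mul_mem hy w_mem) (H.mul_mem hw₁ hp)
        (H.smul_mem _ (H.mul_mem hq w_mem)), t₁, t₂, t₃, t₄, mul_add w', add_mul _ _ w]
  have hfix : ∀ x ∈ H, ψ x = x := fun x hx => by
    simpa using hψ x hx 0 H.zero_mem
  have hinj : Function.Injective ψ := by
    intro z t hzt
    have h0 : ψ (z - t) = 0 := by
      have := hadd (z - t) t
      rwa [sub_add_cancel, hzt, right_eq_add] at this
    obtain ⟨x, hx, y, hy, hxy⟩ := dec (z - t)
    rw [hxy, hψ x hx y hy] at h0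
    obtain ⟨h1, h2⟩ := P.eq_zero_of_add_mul_eq_zero one_mem hH e_ne he hx
      (H.mul_mem (H.mul_mem hw₁ hy) w_mem) h0
    have h3 : y = 0 := by
      rw [← P.inv_cancel_left hw₁w y, ← P.inv_cancel_right hww₁ (w' * y), h2, zero_mul, mul_zero]
    rw [← sub_eq_zero, hxy, h1, h3, mul_zero, add_zero]
  have hsurj : Function.Surjective ψ := by
    intro z
    obtain ⟨x, hx, y, hy, rfl⟩ := dec z
    refine ⟨x + e * (w * y * w'), ?_⟩
    rw [hψ x hx _ (H.mul_mem (H.mul_mem w_mem hy) hw₁), assoc w_mem hy hw₁,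
      P.inv_cancel_left hww₁, P.inv_cancel_right hw₁w]
  exact ⟨⟨Equiv.ofBijective ψ ⟨hinj, hsurj⟩, hadd, hfix 1 one_mem,
    P.isIsotopic_triple hw₁w hiso⟩, rfl, hiso⟩

/-- A dimension count: a linear map from dimension `8` to dimension `4` has a non-zero kernel. -/
theorem exists_orthogonal {H : NonUnitalSubalgebra K O} (hH : IsQuaternionDivisionAlgebra K H) :
    ∃ e : O, e ≠ 0 ∧ ∀ x ∈ H, P.polar e x = 0 := by
  have := P.finite
  have := Module.finite_of_finrank_eq_succ hH.finrank_eq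
  let L : O →ₗ[K] (H →ₗ[K] K) := LinearMap.mk₂ K (fun x y => P.polar x y)
    (fun x y z => P.polar_add_left x y z) (fun k x y => P.polar_smul_left k x y)
    (fun x y z => P.polar_add_right x y z) (fun k x y => P.polar_smul_right k x y)
  have hker : LinearMap.ker L ≠ ⊥ := LinearMap.ker_ne_bot_of_finrank_lt (by
    rw [Module.finrank_linearMap, hH.finrank_eq, P.finrank_eq, Module.finrank_self]; norm_num)
  obtain ⟨e, he, hne⟩ := Submodule.exists_mem_ne_zero_of_ne_bot hker
  exact ⟨e, hne, fun x hx => LinearMap.congr_fun (LinearMap.mem_ker.1 he) ⟨x, hx⟩⟩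

/-! ### Every octonion lies in a quaternion subalgebra. -/

/-- The embedding of the quadratic field from which the octonion algebra is built. -/
def ofField (x : P.H.E) : O := P.equiv.symm (Doubling.mk (Doubling.mk x 0) 0)

/-- The component of an octonion in the quadratic field. -/
def fieldPart (x : O) : P.H.E := (P.equiv x).fst.fst

theorem fieldPart_ofField (x : P.H.E) : P.fieldPart (P.ofField x) = x := by
  simp [fieldPart, ofField]

theorem fieldPart_sub (x y : O) : P.fieldPart (x - y) = P.fieldPart x - P.fieldPart y := by
  simp [fieldPart]

theorem ofField_add (x y : P.H.E) : P.ofField (x + y) = P.ofField x + P.ofField y :=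
  P.equiv.injective (by
    simp only [ofField, map_add, P.equiv.apply_symm_apply]
    exact Doubling.ext (Doubling.ext (by simp) (by simp)) (by simp))

theorem ofField_smul (k : K) (x : P.H.E) : P.ofField (k • x) = k • P.ofField x :=
  P.equiv.injective (by
    simp only [ofField, map_smul, P.equiv.apply_symm_apply]
    exact Doubling.ext (Doubling.ext (by simp) (by simp)) (by simp))

theorem ofField_mul (x y : P.H.E) : P.ofField (x * y) = P.ofField x * P.ofField y :=
  P.equiv.injective (by
    simp only [ofField, P.map_mul, P.equiv.apply_symm_apply]
    exact Doubling.ext (Doubling.ext (by simp [Involution.map_zero])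
      (by simp [Involution.map_zero])) (by simp))

theorem ofField_one : P.ofField 1 = 1 :=
  P.equiv.injective (by
    simp only [ofField, P.map_one, P.equiv.apply_symm_apply]
    rfl)

theorem ofField_zero : P.ofField 0 = 0 := by
  simpa using P.ofField_smul 0 0

theorem ofField_conj (x : P.H.E) : P.ofField (P.H.σ x) = P.conj (P.ofField x) :=
  P.equiv.injective (by
    simp only [ofField, P.equiv_conj, P.equiv.apply_symm_apply]
    exact Doubling.ext (Doubling.ext (by simp) (by simp)) (by simp))

theorem polar_ofField {y : O} (hy : P.fieldPart y = 0) (x : P.H.E) :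
    P.polar y (P.ofField x) = 0 := by
  apply P.smul_one_injective
  rw [← P.bilin_eq, zero_smul]
  apply P.equiv.injective
  rw [fieldPart] at hy
  rw [bilin, map_add, P.map_mul, P.map_mul, P.equiv_conj, P.equiv_conj, ofField,
    P.equiv.apply_symm_apply, map_zero]
  refine Doubling.ext (Doubling.ext ?_ ?_) ?_ <;>
    simp [Involution.map_zero, hy]

/-- The subalgebra `E ⊕ y E` is a quaternion division algebra, for `y ≠ 0` orthogonal to the
quadratic field `E`. -/
theorem exists_quaternion_subalgebra {y : O} (hy : P.fieldPart y = 0) (y_ne : y ≠ 0) :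
    ∃ H : NonUnitalSubalgebra K O, IsQuaternionDivisionAlgebra K H ∧
      ∀ x z : P.H.E, P.ofField x + y * P.ofField z ∈ H := by
  have hp := P.polar_ofField hy
  have ht : P.tr y = 0 := by rw [← P.polar_one_right, ← P.ofField_one, hp]
  have hmem : ∀ x, y ≠ P.ofField x := by
    rintro x rfl
    rw [P.fieldPart_ofField] at hy
    exact y_ne (by rw [hy, P.ofField_zero])
  let D : QuaternionData.{u, v} K :=
    { E := P.H.E
      separable := P.H.separable
      finrank_eq := P.H.finrank_eq
      σ := P.H.σ
      σ_nontrivial := P.H.σ_nontrivial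
      b := -P.nm y
      b_ne_zero := neg_ne_zero.2 fun h => y_ne (P.nm_eq_zero.1 h)
      -- If `-N(y) = N(x)` with `x ∈ E`, orthogonality gives `N(y + x) = 0`. Then `y = -x` lies in
      -- `E`, which is impossible as its `E`-coordinate is zero and `y ≠ 0`.
      b_not_norm := by
        rintro ⟨x, hx⟩
        have hn : P.nm (P.ofField x) = -P.nm y := P.nm_eq_of (by
          rw [← P.ofField_conj, ← P.ofField_mul, hx, P.ofField_smul, P.ofField_one])
        have h0 : P.nm (y + P.ofField x) = 0 := by
          rw [P.nm_add, hn, hp]; ring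
        apply hmem (-x)
        rw [← neg_one_smul K x, P.ofField_smul, neg_one_smul]
        exact eq_neg_of_add_eq_zero_left (P.nm_eq_zero.1 h0) }
  let g : D.Alg →ₗ[K] O :=
    { toFun := fun z => P.ofField z.fst + y * P.ofField z.snd
      map_add' := fun z t => by
        simp only [Doubling.fst_add, Doubling.snd_add, P.ofField_add, mul_add]
        abel
      map_smul' := fun k z => by
        simp only [Doubling.fst_smul, Doubling.snd_smul, P.ofField_smul, P.mul_smul, smul_add,
          RingHom.id_apply] }
  have g_apply : ∀ z, g z = P.ofField z.fst + y * P.ofField z.snd := fun _ => rfl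
  have g_mul : ∀ z t, g (z * t) = g z * g t := by
    intro z t
    rw [g_apply, g_apply, g_apply, Doubling.fst_mul, Doubling.snd_mul, add_mul, mul_add, mul_add,
      P.mul_orth ht (hp _), P.orth_mul ht (hp _) (hp _) (by rw [← P.ofField_mul, hp]),
      P.orth_mul_orth ht (hp _) (by rw [← P.ofField_conj, ← P.ofField_mul, hp])]
    simp only [← P.ofField_conj, ← P.ofField_mul, ← P.ofField_smul]
    rw [P.ofField_add, P.ofField_add, mul_add]
    abel
  have g_inj : Function.Injective g := by
    rw [injective_iff_map_eq_zero]
    intro z hz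
    rw [g_apply] at hz
    have h2 : z.snd = 0 := by
      by_contra hne
      have hinv : P.ofField z.snd * P.ofField z.snd⁻¹ = 1 := by
        rw [← P.ofField_mul, mul_inv_cancel₀ hne, P.ofField_one]
      apply hmem (-z.fst * z.snd⁻¹)
      rw [P.ofField_mul, ← neg_one_smul K z.fst, P.ofField_smul, neg_one_smul,
        ← eq_neg_of_add_eq_zero_right hz, P.inv_cancel_right hinv]
    rw [h2, P.ofField_zero, mul_zero, add_zero] at hz
    have h1 : z.fst = 0 := by
      rw [← P.fieldPart_ofField z.fst, hz]
      simp [fieldPart]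
    exact Doubling.ext h1 h2
  let H : NonUnitalSubalgebra K O :=
    { LinearMap.range g with
      mul_mem' := by
        rintro _ _ ⟨z, rfl⟩ ⟨t, rfl⟩
        exact ⟨z * t, g_mul z t⟩ }
  let f : D.Alg ≃ₗ[K] H := LinearEquiv.ofInjective g g_inj
  refine ⟨H, ⟨D, f.symm, fun x y => ?_⟩, fun x z => ⟨Doubling.mk x z, rfl⟩⟩
  apply f.injective
  rw [f.apply_symm_apply]
  apply Subtype.ext
  have hf : ∀ z, (f z : O) = g z := fun _ => rfl
  have hf' : ∀ x : H, g (f.symm x) = x := fun x => by rw [← hf, f.apply_symm_apply]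
  rw [hf, g_mul, hf', hf']
  rfl

theorem exists_quaternion_subalgebra_mem (P : OctonionDivisionAlgebra K O)
    (a : O) : ∃ H : NonUnitalSubalgebra K O,
    (1 : O) ∈ H ∧ IsQuaternionDivisionAlgebra K H ∧ a ∈ H := by
  set y := a - P.ofField (P.fieldPart a) with hy
  have hy0 : P.fieldPart y = 0 := by rw [hy, P.fieldPart_sub, P.fieldPart_ofField, sub_self]
  have ha : a = P.ofField (P.fieldPart a) + y := by rw [hy]; abel
  by_cases h : y = 0
  -- Here `a` lies in `E`, and any non-zero element with zero `E`-coordinate serves; the generator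
  -- of the outer double is taken.
  · have hj : P.equiv.symm (Doubling.mk 0 1) ≠ 0 := fun h' => by
      have := congrArg (fun z => z.snd.fst) ((LinearEquiv.symm_apply_eq _).1 h')
      simp at this
    obtain ⟨H, hH, hmem⟩ := P.exists_quaternion_subalgebra (by simp [fieldPart]) hj
    have hm : ∀ x, P.ofField x ∈ H := fun x => by
      simpa [P.ofField_zero] using hmem x 0
    refine ⟨H, P.ofField_one ▸ hm 1, hH, ?_⟩
    rw [ha, h, add_zero]
    exact hm _
  · obtain ⟨H, hH, hmem⟩ := P.exists_quaternion_subalgebra hy0 h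
    refine ⟨H, ?_, hH, ?_⟩
    · simpa [P.ofField_zero, P.ofField_one] using hmem 1 0
    · rw [ha]
      simpa [P.ofField_one] using hmem (P.fieldPart a) 1

/-! ### Identification of `Γ` and the direct product. -/

theorem mem_Gamma_of_mem_isotopyGroup {γ : jordanAut O} (h : γ ∈ P.isotopyGroup) :
    ⇑γ.1 ∈ P.Gamma := by
  obtain ⟨a, a', ha, hγ⟩ := h
  obtain ⟨H, one_mem, hH, a_mem⟩ := P.exists_quaternion_subalgebra_mem a
  obtain ⟨e, e_ne, he⟩ := P.exists_orthogonal hH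
  have ha' := P.inv_comm ha
  have a'_ne : a' ≠ 0 := fun h0 => P.ne_zero_of_mul_eq_one ha' (P.nm_eq_zero.2 h0)
  -- With `w = a⁻¹` the map `ψ` has parameter `a`, the same as `γ`; therefore `ψ⁻¹ ∘ γ` is
  -- multiplicative.
  obtain ⟨ψ, hψ⟩ := P.exists_isPsi one_mem hH e_ne he
    (P.inv_mem_subalgebra one_mem a_mem ha) a'_ne
  obtain ⟨δ, hδ, hiso⟩ := P.exists_isotopic_of_isPsi hψ ha'
  have hi : ∀ x, δ.1 ((δ⁻¹ * γ).1 x) = γ.1 x := fun x => δ.1.apply_symm_apply _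
  refine ⟨ψ, ⟨H, e, a', hψ⟩, { (δ⁻¹ * γ).1 with
    map_add' := jordanAut.map_add (δ⁻¹ * γ)
    map_mul' := fun x y => ?_ }, ?_⟩
  · change (δ⁻¹ * γ).1 (x * y) = (δ⁻¹ * γ).1 x * (δ⁻¹ * γ).1 y
    apply δ.1.injective
    rw [hi, hδ, hiso, ← hδ, hi, hi, hγ]
  · funext x
    change γ.1 x = ψ ((δ⁻¹ * γ).1 x)
    rw [← hδ, hi]

theorem image_isotopyGroup :
    (fun γ : jordanAut O => (⇑γ.1 : O → O)) '' (P.isotopyGroup : Set (jordanAut O)) = P.Gamma := by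
  apply Set.Subset.antisymm
  · rintro _ ⟨γ, hγ, rfl⟩
    exact P.mem_Gamma_of_mem_isotopyGroup hγ
  · rintro _ ⟨ψ, ⟨H, e, w, hψ⟩, φ, rfl⟩
    obtain ⟨w', hw⟩ := P.exists_inv hψ.w_ne_zero
    obtain ⟨δ, hδ, hiso⟩ := P.exists_isotopic_of_isPsi hψ hw
    let f : jordanAut O := ⟨φ.toEquiv, map_add φ, _root_.map_one φ, fun x y => by
      simp [_root_.map_mul]⟩
    have hf : f ∈ P.isotopyGroup := ⟨1, 1, one_mul 1, fun x y => by
      rw [mul_one, one_mul]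
      exact _root_.map_mul φ x y⟩
    refine ⟨δ * f, mul_mem ⟨w', w, P.inv_comm hw, hδ ▸ hiso⟩ hf, ?_⟩
    rw [← hδ]
    rfl

theorem zpowers_inf_isotopyGroup {x : jordanAut O} (hx : x ∈ Subgroup.zpowers P.conjJordan)
    (hx' : x ∈ P.isotopyGroup) : x = 1 := by
  obtain ⟨n, rfl⟩ := Subgroup.mem_zpowers_iff.1 hx
  rcases Int.even_or_odd' n with ⟨m, rfl | rfl⟩
  · rw [zpow_mul, zpow_two, P.conjJordan_mul_self, one_zpow]
  · rw [zpow_add, zpow_mul, zpow_two, P.conjJordan_mul_self, one_zpow, one_mul, zpow_one] at hx'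
    exact absurd hx' P.conjJordan_notMem

/-- Multiplication `⟨σ⟩ × Γ → Aut_J(O)`. -/
def productHom : Subgroup.zpowers P.conjJordan × P.isotopyGroup →* jordanAut O :=
  (Subgroup.zpowers P.conjJordan).subtype.noncommCoprod P.isotopyGroup.subtype fun a g => by
    have h : (a : jordanAut O) ∈ Subgroup.center (jordanAut O) :=
      (Subgroup.zpowers_le.2 P.conjJordan_mem_center) a.2
    exact (Subgroup.mem_center_iff.1 h g).symm

theorem productHom_injective : Function.Injective P.productHom := by
  rw [injective_iff_map_eq_one]
  rintro ⟨a, g⟩ h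
  have h' : (a : jordanAut O) * g = 1 := h
  have ha : (a : jordanAut O) = 1 := P.zpowers_inf_isotopyGroup a.2 (by
    rw [eq_inv_of_mul_eq_one_left h']
    exact inv_mem g.2)
  rw [ha, one_mul] at h'
  exact Prod.ext (Subtype.ext ha) (Subtype.ext h')

theorem productHom_range : P.productHom.range = P.generated := by
  apply le_antisymm
  · rw [P.generated_eq_top]
    exact le_top
  · rw [generated, Subgroup.closure_le]
    rintro x (rfl | hx)
    · exact ⟨(⟨_, Subgroup.mem_zpowers _⟩, 1), mul_one _⟩
    · exact ⟨(1, ⟨x, hx⟩), one_mul _⟩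

end OctonionDivisionAlgebra

theorem mainTheorem3 {K : Type u} {O : Type v} [Field K] [NonAssocRing O] [Module K O]
    (P : OctonionDivisionAlgebra K O) :
    ∃ (s : jordanAut O) (Γ : Subgroup (jordanAut O)),
      (∀ x : O, s.1 x = P.conj x) ∧
      (fun γ : jordanAut O => (⇑γ.1 : O → O)) '' (Γ : Set (jordanAut O)) = P.Gamma ∧
      s ∈ Subgroup.center (jordanAut O) ∧
      Subgroup.closure ({s} ∪ (Γ : Set (jordanAut O))) = ⊤ ∧
      ∃ F : Subgroup.zpowers s × Γ ≃* Subgroup.closure ({s} ∪ (Γ : Set (jordanAut O))),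
        ∀ (a : Subgroup.zpowers s) (g : Γ), (F (a, g) : jordanAut O) = a * g := by
  refine ⟨P.conjJordan, P.isotopyGroup, P.conjJordan_apply, P.image_isotopyGroup,
    P.conjJordan_mem_center, P.generated_eq_top,
    (MonoidHom.ofInjective P.productHom_injective).trans
      (MulEquiv.subgroupCongr P.productHom_range), fun a g => rfl⟩
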